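/- Let $\mathfrak g=\mathfrak{sl}(n,\mathbb C)$ with $n\ge 1$. Let $\mathfrak h$ be its diagonal Cartan subalgebra, and let $\mathfrak n\subset\mathfrak b$ be the subalgebras of strictly upper triangular and upper triangular matrices. Let $e_i\in\mathfrak h^*$ be the $i$-th diagonal entry, let $\Phi^+=\{e_i-e_j: i<j\}$, and let $\rho=\frac12\sum_{\beta\in\Phi^+}\beta$. For $\beta=e_i-e_j\in\Phi^+$ put $\langle\nu,\beta^\vee\rangle=\nu(E_{i,i}-E_{j,j})$ and $s_\beta\nu=\nu-\langle\nu,\beta^\vee\rangle\beta$, and let $w\cdot\nu=w(\nu+\rho)-\rho$ be the dot action of the Weyl group on $\mathfrak h^*$. For $\lambda\in\mathfrak h^*$ let $M(\lambda)=U(\mathfrak g)\otimes_{U(\mathfrak b)}\mathbb C v_\lambda$ be the Verma module of highest weight $\lambda$. A singular vector of $M(\lambda)$ is a (nonzero) weight vector $v$ with $\mathfrak n\cdot v=0$. Let $\lambda,\mu\in\mathfrak h^*$ and suppose that $\mu$ is strongly linked to $\lambda$ by $\alpha_k,\dots,\alpha_1\in\Phi^+$ ($k\ge 0$), that is, $\mu=s_{\alpha_k}\cdots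 s_{\alpha_1}\cdot\lambda$, and for each $j=1,\dots,k$ the number $\langle (s_{\alpha_{j-1}}\cdots s_{\alpha_1}\cdot\lambda)+\rho,\alpha_j^\vee\rangle$ is a positive integer. Write $$\lambda-\mu=\sum_{i=1}^{n-1}a_i(e_i-e_{i+1}),\qquad a_i\in\mathbb C .$$ Then every $a_i$ is a nonnegative integer, and $M(\lambda)$ contains a singular vector $v$ of weight $\mu$ of the form $$v=E_{2,1}^{a_1}E_{3,2}^{a_2}\cdots E_{n,n-1}^{a_{n-1}}v_\lambda+\sum_{b:\ |b|<a_1+\cdots+a_{n-1}}c_bE^bv_\lambda ,$$ a finite sum with $c_b\in\mathbb C$. Here $b=(b_{i,j})_{1\le j<i\le n}$ runs over families of nonnegative integers, $E^b=E_{2,1}^{b_{2,1}}E_{3,1}^{b_{3,1}}E_{3,2}^{b_{3,2}}E_{4,1}^{b_{4,1}}\cdots E_{n,1}^{b_{n,1}}\cdots E_{n,n-1}^{b_{n,n-1}}$, and $|b|=\sum_{i>j}b_{i,j}$ is the degree of $E^b$. -/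

import Mathlib

open scoped TensorProduct

attribute [local instance] LieRing.ofAssociativeRing

noncomputable section

namespace SlVerma

/-! ### The Lie algebra `sl(n, ℂ)`, with `n = r + 1`, and its standard subalgebras

Matrix indices run over `Fin (r + 1)`, so that the index `i` below is the index `i + 1` of the
usual notation. -/

/-- The Lie algebra `𝔤 = sl(n, ℂ)`, `n = r + 1`. -/
abbrev SL (r : ℕ) : LieSubalgebra ℂ (Matrix (Fin (r + 1)) (Fin (r + 1)) ℂ) :=
  LieAlgebra.SpecialLinear.sl (Fin (r + 1)) ℂ

/-- The Cartan subalgebra `𝔥` of diagonal matrices of trace zero. -/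
def cartan (r : ℕ) : LieSubalgebra ℂ (SL r) where
  carrier := {A | ∀ i j, i ≠ j → A.1 i j = 0}
  add_mem' := by
    intro A B hA hB i j h
    simp [hA i j h, hB i j h]
  zero_mem' := by
    intro i j _
    rfl
  smul_mem' := by
    intro c A hA i j h
    simp [hA i j h]
  lie_mem' := by
    intro A B hA hB i j h
    rw [LieAlgebra.SpecialLinear.sl_bracket, Matrix.sub_apply, Matrix.mul_apply, Matrix.mul_apply,
      Finset.sum_eq_zero, Finset.sum_eq_zero, sub_zero]
    · intro k _
      by_cases hk : i = k
      · rw [hA k j (hk ▸ h), mul_zero]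
      · rw [hB i k hk, zero_mul]
    · intro k _
      by_cases hk : i = k
      · rw [hB k j (hk ▸ h), mul_zero]
      · rw [hA i k hk, zero_mul]

/-- The Borel subalgebra `𝔟 = 𝔥 ⊕ 𝔫` of upper triangular matrices of trace zero. -/
def borel (r : ℕ) : LieSubalgebra ℂ (SL r) where
  carrier := {A | ∀ i j, j < i → A.1 i j = 0}
  add_mem' := by
    intro A B hA hB i j h
    simp [hA i j h, hB i j h]
  zero_mem' := by
    intro i j _
    rfl
  smul_mem' := by
    intro c A hA i j h
    simp [hA i j h]
  lie_mem' := by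
    intro A B hA hB i j h
    rw [LieAlgebra.SpecialLinear.sl_bracket, Matrix.sub_apply, Matrix.mul_apply, Matrix.mul_apply,
      Finset.sum_eq_zero, Finset.sum_eq_zero, sub_zero]
    · intro k _
      rcases lt_or_ge k i with hk | hk
      · rw [hB i k hk, zero_mul]
      · rw [hA k j (h.trans_le hk), mul_zero]
    · intro k _
      rcases lt_or_ge k i with hk | hk
      · rw [hA i k hk, zero_mul]
      · rw [hB k j (h.trans_le hk), mul_zero]

/-- The subalgebra `𝔫` of strictly upper triangular matrices, the sum of the positive root
spaces. -/
def nilp (r : ℕ) : LieSubalgebra ℂ (SL r) where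
  carrier := {A | ∀ i j, j ≤ i → A.1 i j = 0}
  add_mem' := by
    intro A B hA hB i j h
    simp [hA i j h, hB i j h]
  zero_mem' := by
    intro i j _
    rfl
  smul_mem' := by
    intro c A hA i j h
    simp [hA i j h]
  lie_mem' := by
    intro A B hA hB i j h
    rw [LieAlgebra.SpecialLinear.sl_bracket, Matrix.sub_apply, Matrix.mul_apply, Matrix.mul_apply,
      Finset.sum_eq_zero, Finset.sum_eq_zero, sub_zero]
    · intro k _
      rcases le_or_gt k i with hk | hk
      · rw [hB i k hk, zero_mul]
      · rw [hA k j (h.trans hk.le), mul_zero]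
    · intro k _
      rcases le_or_gt k i with hk | hk
      · rw [hA i k hk, zero_mul]
      · rw [hB k j (h.trans hk.le), mul_zero]

/-- The space `𝔥*` of weights. -/
abbrev Wt (r : ℕ) := Module.Dual ℂ (cartan r)

/-! ### Roots, the Weyl group, the dot action, strong linkage -/

/-- The restriction to `𝔥` of the function `e_i`, the `i`-th diagonal entry. -/
def e {r : ℕ} (i : Fin (r + 1)) : Wt r where
  toFun H := H.1.1 i i
  map_add' _ _ := rfl
  map_smul' _ _ := rfl

/-- The pairs `i < j`, indexing the positive roots `e_i - e_j`. -/
abbrev PosRoot (r : ℕ) := {p : Fin (r + 1) × Fin (r + 1) // p.1 < p.2}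

/-- The positive root `e_i - e_j`, as a weight. -/
def root {r : ℕ} (β : PosRoot r) : Wt r := e β.1.1 - e β.1.2

/-- The coroot `E_{i,i} - E_{j,j} ∈ 𝔥` of `β = e_i - e_j`: `⟨μ, β^∨⟩ = μ (coroot β)`. -/
def coroot {r : ℕ} (β : PosRoot r) : cartan r :=
  ⟨LieAlgebra.SpecialLinear.singleSubSingle β.1.1 β.1.2 (1 : ℂ), by
    intro i j h
    have h1 : ∀ k : Fin (r + 1), Matrix.single k k (1 : ℂ) i j = 0 := fun k =>
      Matrix.single_apply_of_ne _ _ _ _ _ (fun hk => h (hk.1.symm.trans hk.2))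
    rw [LieAlgebra.SpecialLinear.val_singleSubSingle, Matrix.sub_apply, h1, h1, sub_zero]⟩

/-- Half the sum of the positive roots. -/
def rho (r : ℕ) : Wt r := (1 / 2 : ℂ) • ∑ β : PosRoot r, root β

/-- The reflection `s_β : μ ↦ μ - ⟨μ, β^∨⟩ β` of `𝔥*`. -/
def refl {r : ℕ} (β : PosRoot r) : Module.End ℂ (Wt r) :=
  LinearMap.id - (Module.Dual.eval ℂ (cartan r) (coroot β)).smulRight (root β)

/-- The dot action `w · μ = w (μ + ρ) - ρ`. -/
def dot {r : ℕ} (w : Module.End ℂ (Wt r)) (μ : Wt r) : Wt r := w (μ + rho r) - rho r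

/-- The Weyl group element `s_{β_1} ⋯ s_{β_k}` attached to the list `[β_1, …, β_k]`. -/
def word {r : ℕ} (l : List (PosRoot r)) : Module.End ℂ (Wt r) := (l.map refl).prod

/-- The elementary relation `μ ↑ λ` through `β`: one has `μ = s_β · λ`, and
`⟨λ + ρ, β^∨⟩` is a positive integer. -/
def Up {r : ℕ} (β : PosRoot r) (μ lam : Wt r) : Prop :=
  μ = dot (refl β) lam ∧ ∃ m : ℕ, 0 < m ∧ (lam + rho r) (coroot β) = (m : ℂ)

/-- `μ` is strongly linked to `λ` by the list `[β_1, …, β_k]` of positive roots: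
`μ = (s_{β_1} ⋯ s_{β_k}) · λ ↑ (s_{β_2} ⋯ s_{β_k}) · λ ↑ ⋯ ↑ s_{β_k} · λ ↑ λ`.
The empty list gives `μ = λ`. -/
def StronglyLinkedBy {r : ℕ} (l : List (PosRoot r)) (μ lam : Wt r) : Prop :=
  μ = dot (word l) lam ∧
    ∀ (β : PosRoot r) (l' : List (PosRoot r)), (β :: l') <:+ l →
      Up β (dot (word (β :: l')) lam) (dot (word l') lam)

/-! ### Verma modules -/

/-- The universal enveloping algebra `U(𝔤)`. -/
abbrev U (r : ℕ) := UniversalEnvelopingAlgebra ℂ (SL r)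

/-- The universal enveloping algebra `U(𝔟)`. -/
abbrev UB (r : ℕ) := UniversalEnvelopingAlgebra ℂ (borel r)

/-- The homomorphism `U(𝔟) → U(𝔤)` induced by the inclusion. -/
def inclU (r : ℕ) : UB r →ₐ[ℂ] U r :=
  UniversalEnvelopingAlgebra.lift ℂ
    ((UniversalEnvelopingAlgebra.ι ℂ).comp (borel r).incl)

/-- The diagonal part of a matrix of trace zero. -/
def diagPart (r : ℕ) : SL r →ₗ[ℂ] cartan r where
  toFun A := ⟨⟨Matrix.diagonal fun i => A.1 i i, by
      have h : Matrix.trace A.1 = 0 := A.2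
      change Matrix.trace (Matrix.diagonal fun i => A.1 i i) = 0
      rw [Matrix.trace_diagonal]
      exact h⟩,
    fun _ _ h => Matrix.diagonal_apply_ne _ h⟩
  map_add' A B := by
    ext i j
    simp [Matrix.diagonal_apply]
  map_smul' c A := by
    ext i j
    simp [Matrix.diagonal_apply]

theorem diagPart_lie {r : ℕ} (A B : borel r) : diagPart r ⁅(A : SL r), (B : SL r)⁆ = 0 := by
  have key : ∀ (A B : borel r) (i : Fin (r + 1)),
      (A.1.1 * B.1.1) i i = A.1.1 i i * B.1.1 i i := by
    intro A B i
    rw [Matrix.mul_apply]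
    refine Finset.sum_eq_single i (fun k _ hk => ?_) (fun h => (h (Finset.mem_univ i)).elim)
    rcases lt_or_gt_of_ne hk with hk | hk
    · rw [A.2 i k hk, zero_mul]
    · rw [B.2 k i hk, mul_zero]
  ext i j
  change Matrix.diagonal (fun i => (⁅(A : SL r), (B : SL r)⁆).1 i i) i j = 0
  rw [Matrix.diagonal_apply, LieAlgebra.SpecialLinear.sl_bracket, Matrix.sub_apply, key, key,
    mul_comm, sub_self, ite_self]

/-- The one-dimensional representation of `𝔟` of weight `λ`, on which `𝔫` acts by zero. -/
def charB {r : ℕ} (lam : Wt r) : borel r →ₗ⁅ℂ⁆ ℂ where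
  toLinearMap := lam ∘ₗ diagPart r ∘ₗ (borel r).toSubmodule.subtype
  map_lie' := by
    intro A B
    change lam (diagPart r ⁅(A : SL r), (B : SL r)⁆) = _
    rw [diagPart_lie, map_zero, LieRing.of_associative_ring_bracket, mul_comm, sub_self]

/-- The action of `U(𝔟)` on the one-dimensional module `ℂ v_λ`. -/
def charU {r : ℕ} (lam : Wt r) : UB r →ₐ[ℂ] ℂ := UniversalEnvelopingAlgebra.lift ℂ (charB lam)

/-- The relations that make `U(𝔤) ⊗ ℂ v_λ` balanced over `U(𝔟)`. -/
def balanced {r : ℕ} (lam : Wt r) : Submodule (U r) (U r ⊗[ℂ] ℂ) :=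
  Submodule.span (U r)
    {x | ∃ (u : U r) (b : UB r) (z : ℂ),
      x = (u * inclU r b) ⊗ₜ[ℂ] z - u ⊗ₜ[ℂ] (charU lam b * z)}

/-- The Verma module `M(λ) = U(𝔤) ⊗_{U(𝔟)} ℂ v_λ`, a left `U(𝔤)`-module. -/
abbrev Verma {r : ℕ} (lam : Wt r) := (U r ⊗[ℂ] ℂ) ⧸ balanced lam

/-- The canonical generator `v_λ` of `M(λ)`. -/
def vac {r : ℕ} (lam : Wt r) : Verma lam := (balanced lam).mkQ (1 ⊗ₜ[ℂ] 1)

/-- `v` is a weight vector of weight `μ` in the `U(𝔤)`-module `M`. -/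
def IsWeightVector {r : ℕ} {lam : Wt r} (μ : Wt r) (v : Verma lam) : Prop :=
  v ≠ 0 ∧ ∀ H : cartan r, UniversalEnvelopingAlgebra.ι ℂ (H : SL r) • v = μ H • v

/-- `v` is a singular vector: a weight vector that `𝔫` annihilates. -/
def IsSingularVector {r : ℕ} {lam : Wt r} (v : Verma lam) : Prop :=
  (∃ μ : Wt r, IsWeightVector μ v) ∧
    ∀ x : nilp r, UniversalEnvelopingAlgebra.ι ℂ (x : SL r) • v = 0

/-! ### PBW monomials -/

/-- The pairs `(i, j)` with `j < i`, indexing the negative root vectors `E_{i,j}`. -/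
abbrev NegIdx (r : ℕ) := {p : Fin (r + 1) × Fin (r + 1) // p.2 < p.1}

/-- The negative root vector `E_{i,j}`, `j < i`, in `U(𝔤)`. -/
def F {r : ℕ} (p : NegIdx r) : U r :=
  UniversalEnvelopingAlgebra.ι ℂ
    (LieAlgebra.SpecialLinear.single p.1.1 p.1.2 p.2.ne' (1 : ℂ) : SL r)

/-- The PBW monomial
`E^a = E_{2,1}^{a_{2,1}} E_{3,1}^{a_{3,1}} E_{3,2}^{a_{3,2}} E_{4,1}^{a_{4,1}} ⋯
E_{n,1}^{a_{n,1}} ⋯ E_{n,n-1}^{a_{n,n-1}}`, ordered by rows and then by columns. -/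
def pbw {r : ℕ} (a : NegIdx r → ℕ) : U r :=
  ((List.finRange (r + 1)).map fun i =>
    ((List.finRange (r + 1)).map fun j =>
      if h : j < i then F ⟨(i, j), h⟩ ^ a ⟨(i, j), h⟩ else 1).prod).prod

/-- The degree `|a|` of `E^a`. -/
def deg {r : ℕ} (a : NegIdx r → ℕ) : ℕ := ∑ p, a p

/-- The monomial `E_{2,1}^{a_1} E_{3,2}^{a_2} ⋯ E_{n,n-1}^{a_{n-1}}`. -/
def lead {r : ℕ} (a : Fin r → ℕ) : U r :=
  (List.ofFn fun i : Fin r => F ⟨(i.succ, i.castSucc), Fin.castSucc_lt_succ⟩ ^ a i).prod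

end SlVerma

end

noncomputable section

namespace SlVerma

/-! ### Matrix units in the enveloping algebra -/

/-! The heart is one reflection, done for any vector `v` of weight `λ` killed by `𝔫` in any
`U(𝔤)`-module `M`. Tensor `M` with polynomials in `x_1, …, x_n`, on which `E_{i,j}` acts by `x_i
∂_j`. For `β = e_p - e_q` and `m = ⟨λ + ρ, β^∨⟩`, start from `v ⊗ x_q^m / m!`, a highest weight
vector for the indices `≥ q`, and extend it downwards one index at a time by `q_i = ∑_a t_a x_i^a
D_i^a q_{i+1}`, where `D_i = ∑_{j>i} E_{j,i} ∂_j`. Each `q_i` also satisfies `∑_{j≥i} E_{j,i} ∂_j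
q_i = c ∂_i q_i` with `c = λ_q - (q - i)`, and this turns annihilation by the total action of
`E_{i,i+1}` into a two-term recursion for `t_a`. At `p` apply `D_p^m` to `q_{p+1}` instead and take
the constant term. Commuting `E_{p,p+1}` through gives the factor `m (λ_p - m + 1 - c)`, which is
zero by the hypothesis on `m`.

Counting negative root vectors shows that the new vector is `u • v`, with `u` equal to `E_{p+1,p}^m
⋯ E_{q,q-1}^m` up to products of fewer factors. Commutators of negative root vectors are again
combinations of negative root vectors, so reordering costs only shorter products. Hence the elements
`u` of successive reflections multiply, the leading exponents add, and the remainder is a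
combination of shorter PBW monomials. Intermediate vectors need not be known to be nonzero.

Nonvanishing is proved once, at the end, without linear independence of PBW monomials. Twisted
vector fields make `𝔤` act on the polynomial functions on the lower unipotent group, and `v_λ ↦`
(evaluation at the identity) induces a map from `M(λ)` to the dual. A negative root vector acts
there by a coordinate derivative, up to terms that preserve the order of vanishing. So a product of
negative root vectors pairs nontrivially with the matching monomial in the coordinates, while
shorter products pair to zero. -/

/-- The projection of a matrix to its trace-free part. -/
def traceFree (r : ℕ) : Matrix (Fin (r + 1)) (Fin (r + 1)) ℂ →ₗ[ℂ] SL r where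
  toFun A := ⟨A - (A.trace / (r + 1 : ℂ)) • 1, by
    have h : ((r : ℂ) + 1) ≠ 0 := by exact_mod_cast r.succ_ne_zero
    change Matrix.trace (A - (A.trace / (r + 1 : ℂ)) • 1) = 0
    rw [Matrix.trace_sub, Matrix.trace_smul, Matrix.trace_one, Fintype.card_fin, smul_eq_mul]
    push_cast
    field_simp
    simp⟩
  map_add' A B := by
    ext i j
    simp [add_div, add_smul]
    ring
  map_smul' c A := by
    ext i j
    simp
    ring

theorem traceFree_coe {r : ℕ} (A : SL r) : traceFree r A.1 = A := by
  have h : Matrix.trace A.1 = 0 := A.2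
  ext i j
  simp [traceFree, h]

theorem lie_traceFree {r : ℕ} (A B : Matrix (Fin (r + 1)) (Fin (r + 1)) ℂ) :
    ⁅traceFree r A, traceFree r B⁆ = traceFree r (A * B - B * A) := by
  apply Subtype.ext
  rw [LieAlgebra.SpecialLinear.sl_bracket]
  simp only [traceFree, LinearMap.coe_mk, AddHom.coe_mk, Matrix.trace_sub, Matrix.trace_mul_comm A B,
    sub_self, zero_div, zero_smul, sub_zero, sub_mul, mul_sub, smul_mul_assoc, mul_smul_comm,
    one_mul, mul_one, smul_sub]
  rw [smul_comm (B.trace / _)]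
  abel

/-- The image in `U(𝔤)` of the trace-free part of the matrix unit `E_{i,j}`. -/
def unit {r : ℕ} (i j : Fin (r + 1)) : U r :=
  UniversalEnvelopingAlgebra.ι ℂ (traceFree r (Matrix.single i j 1))

/-- Scalar matrices are central and commutators have trace zero, so trace-free parts obey the
relations of `gl(n)`. This lets single diagonal units be used inside `U(sl(n))`. -/
theorem unit_mul_unit {r : ℕ} (i j k l : Fin (r + 1)) :
    unit i j * unit k l = unit k l * unit i j
      + (if j = k then unit i l else 0) - (if l = i then unit k j else 0) := by
  have h : ⁅(unit i j : U r), unit k l⁆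
      = (if j = k then unit i l else 0) - (if l = i then unit k j else 0) := by
    rw [unit, unit, ← LieHom.map_lie, lie_traceFree, map_sub, map_sub]
    congr 1
    · by_cases hj : j = k
      · subst hj
        simp [unit]
      · simp [hj]
    · by_cases hj : l = i
      · subst hj
        simp [unit]
      · simp [hj]
  rw [LieRing.of_associative_ring_bracket] at h
  rw [add_sub_assoc, ← h]
  abel

theorem traceFree_single {r : ℕ} {i j : Fin (r + 1)} (h : i ≠ j) :
    traceFree r (Matrix.single i j 1) = LieAlgebra.SpecialLinear.single i j h (1 : ℂ) :=
  traceFree_coe (LieAlgebra.SpecialLinear.single i j h (1 : ℂ))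

theorem F_eq_unit {r : ℕ} (p : NegIdx r) : F p = unit p.1.1 p.1.2 := by
  rw [F, unit, traceFree_single]

/-! ### The degree filtration of `U(𝔫⁻)` -/

/-- The span of the products of fewer than `d` negative root vectors. -/
def filt (r d : ℕ) : Submodule ℂ (U r) :=
  Submodule.span ℂ {u | ∃ l : List (NegIdx r), l.length < d ∧ u = (l.map F).prod}

theorem prod_mem_filt {r d : ℕ} {l : List (NegIdx r)} (h : l.length < d) :
    (l.map F).prod ∈ filt r d :=
  Submodule.subset_span ⟨l, h, rfl⟩

theorem filt_mono {r d d' : ℕ} (h : d ≤ d') : filt r d ≤ filt r d' :=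
  Submodule.span_mono fun _ ⟨l, hl, hu⟩ => ⟨l, hl.trans_le h, hu⟩

theorem filt_zero {r : ℕ} : filt r 0 = ⊥ := by
  rw [filt, Submodule.span_eq_bot]
  rintro _ ⟨l, hl, _⟩
  exact absurd hl (Nat.not_lt_zero _)

/-- The `+ 1` comes from the strict bound in `filt`: at most `a - 1` and `b - 1` factors make at
most `a + b - 2`. -/
theorem mul_mem_filt {r a b d : ℕ} {x y : U r} (hx : x ∈ filt r a) (hy : y ∈ filt r b)
    (h : a + b ≤ d + 1) : x * y ∈ filt r d := by
  induction hx using Submodule.span_induction with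
  | zero => simp
  | add x x' _ _ ih ih' => rw [add_mul]; exact add_mem ih ih'
  | smul c x _ ih => rw [smul_mul_assoc]; exact Submodule.smul_mem _ _ ih
  | mem x hx =>
    obtain ⟨l, hl, rfl⟩ := hx
    induction hy using Submodule.span_induction with
    | zero => simp
    | add x x' _ _ ih ih' => rw [mul_add]; exact add_mem ih ih'
    | smul c x _ ih => rw [mul_smul_comm]; exact Submodule.smul_mem _ _ ih
    | mem x hx =>
      obtain ⟨l', hl', rfl⟩ := hx
      rw [← List.prod_append, ← List.map_append]
      exact prod_mem_filt (by rw [List.length_append]; omega)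

theorem F_mem_filt {r : ℕ} (p : NegIdx r) : F p ∈ filt r 2 := by
  simpa using prod_mem_filt (l := [p]) (d := 2) (by simp)

theorem unit_mem_filt {r : ℕ} {i j : Fin (r + 1)} (h : j < i) : unit i j ∈ filt r 2 := by
  rw [← F_eq_unit ⟨(i, j), h⟩]
  exact F_mem_filt _

theorem F_mul_F_sub_mem {r : ℕ} (p q : NegIdx r) : F p * F q - F q * F p ∈ filt r 2 := by
  rw [F_eq_unit, F_eq_unit, unit_mul_unit, add_sub_assoc, add_sub_cancel_left]
  have hp := p.2
  have hq := q.2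
  refine sub_mem ?_ ?_
  · split_ifs with h
    · exact unit_mem_filt (hq.trans (h ▸ hp))
    · exact zero_mem _
  · split_ifs with h
    · exact unit_mem_filt (hp.trans (h ▸ hq))
    · exact zero_mem _

/-- Swapping two neighbours creates their commutator, a combination of single root vectors, so the
error has one factor fewer. -/
theorem prod_sub_prod_mem_filt {r : ℕ} {l l' : List (NegIdx r)} (h : l.Perm l') :
    (l.map F).prod - (l'.map F).prod ∈ filt r l.length := by
  induction h with
  | nil => simp
  | cons p h ih =>
    rw [List.map_cons, List.map_cons, List.prod_cons, List.prod_cons, ← mul_sub]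
    exact mul_mem_filt (F_mem_filt p) ih (by rw [List.length_cons]; omega)
  | swap p q l =>
    simp only [List.map_cons, List.prod_cons, ← mul_assoc]
    rw [← sub_mul]
    exact mul_mem_filt (F_mul_F_sub_mem q p) (prod_mem_filt (Nat.lt_succ_self _))
      (by simp only [List.length_cons]; omega)
  | trans h₁ h₂ ih₁ ih₂ =>
    rw [← h₁.length_eq] at ih₂
    simpa using add_mem ih₁ ih₂

/-- The list of the factors of the monomial `E^b`. -/
def pbwList {r : ℕ} (b : NegIdx r → ℕ) : List (NegIdx r) :=
  (List.finRange (r + 1)).flatMap fun i => (List.finRange (r + 1)).flatMap fun j =>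
    if h : j < i then List.replicate (b ⟨(i, j), h⟩) ⟨(i, j), h⟩ else []

theorem prod_map_flatMap {α β M : Type*} [Monoid M] (f : β → M) (g : α → List β) (l : List α) :
    ((l.flatMap g).map f).prod = (l.map fun a => ((g a).map f).prod).prod := by
  induction l with
  | nil => simp
  | cons a l ih => simp [ih]

theorem pbw_eq_prod {r : ℕ} (b : NegIdx r → ℕ) : pbw b = ((pbwList b).map F).prod := by
  rw [pbw, pbwList, prod_map_flatMap]
  congr 2
  funext i
  rw [prod_map_flatMap]
  congr 2
  funext j
  split_ifs <;> simp

theorem count_flatMap_of_nodup {α β : Type*} [BEq β] [LawfulBEq β] {l : List α}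
    {g : α → List β} {x : β} {k : α} (hl : l.Nodup) (hk : k ∈ l)
    (hg : ∀ k', k' ≠ k → (g k').count x = 0) : (l.flatMap g).count x = (g k).count x := by
  induction l with
  | nil => simp at hk
  | cons a l ih =>
    rw [List.flatMap_cons, List.count_append]
    rw [List.nodup_cons] at hl
    rcases eq_or_ne k a with rfl | hka
    · have : (l.flatMap g).count x = 0 := by
        rw [List.count_eq_zero, List.mem_flatMap]
        rintro ⟨k', hk', hx⟩
        have := hg k' (fun h => hl.1 (h ▸ hk'))
        rw [List.count_eq_zero] at this
        exact this hx
      omega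
    · rw [hg a hka.symm, zero_add]
      exact ih hl.2 ((List.mem_cons.1 hk).resolve_left hka)

theorem count_pbwList {r : ℕ} [BEq (NegIdx r)] [LawfulBEq (NegIdx r)] (b : NegIdx r → ℕ)
    (p : NegIdx r) :
    (pbwList b).count p = b p := by
  obtain ⟨⟨i, j⟩, h⟩ := p
  rw [pbwList, count_flatMap_of_nodup (k := i) (List.nodup_finRange _) (List.mem_finRange _),
    count_flatMap_of_nodup (k := j) (List.nodup_finRange _) (List.mem_finRange _), dif_pos h,
    List.count_replicate_self]
  · intro j' hj'
    split_ifs with h'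
    · rw [List.count_replicate, if_neg]
      simpa using hj'
    · simp
  · intro i' hi'
    rw [List.count_eq_zero, List.mem_flatMap]
    rintro ⟨j', -, hj'⟩
    split_ifs at hj' with h'
    · have := List.eq_of_mem_replicate hj'
      simp only [Subtype.mk.injEq, Prod.mk.injEq] at this
      exact hi' this.1.symm
    · simp at hj'

theorem sum_count {α : Type*} [Fintype α] [BEq α] [LawfulBEq α] (l : List α) :
    ∑ p, l.count p = l.length := by
  induction l with
  | nil => simp
  | cons a l ih =>
    classical
    simp [List.count_cons, Finset.sum_add_distrib, ih]

/-- The spanning half of PBW for `𝔫⁻`: sort a product, and treat the shorter error by induction on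
`d`. -/
theorem filt_le_span_pbw {r : ℕ} (d : ℕ) :
    filt r d ≤ Submodule.span ℂ (pbw '' {b : NegIdx r → ℕ | deg b < d}) := by
  induction d with
  | zero => rw [filt_zero]; exact bot_le
  | succ d ih =>
    refine Submodule.span_le.2 ?_
    rintro _ ⟨l, hl, rfl⟩
    -- The exponents of the sorted monomial are the multiplicities in `l`.
    have hp : l.Perm (pbwList fun p => l.count p) := by
      refine List.perm_iff_count.2 fun p => ?_
      rw [count_pbwList]
    have h := prod_sub_prod_mem_filt hp
    have h' := ih (filt_mono (Nat.le_of_lt_succ hl) h)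
    rw [← sub_add_cancel ((l.map F).prod) _]
    refine add_mem (Submodule.span_mono (Set.image_mono fun b hb => ?_) h')
      (Submodule.subset_span ⟨fun p => l.count p, ?_, pbw_eq_prod _⟩)
    · exact Nat.lt_succ_of_lt hb
    · change ∑ p, l.count p < d + 1
      rwa [sum_count]

/-! ### Products of simple negative root vectors -/

/-- The pair `(i + 1, i)`, indexing the negative of a simple root. -/
def simple {r : ℕ} (i : Fin r) : NegIdx r := ⟨(i.succ, i.castSucc), Fin.castSucc_lt_succ⟩

/-- The list of the factors of the monomial `lead a`. -/
def leadList {r : ℕ} (a : Fin r → ℕ) : List (NegIdx r) :=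
  (List.finRange r).flatMap fun i => List.replicate (a i) (simple i)

theorem lead_eq_prod {r : ℕ} (a : Fin r → ℕ) : lead a = ((leadList a).map F).prod := by
  rw [leadList, prod_map_flatMap, lead, List.ofFn_eq_map]
  congr 2
  funext i
  simp [simple]

theorem length_leadList {r : ℕ} (a : Fin r → ℕ) : (leadList a).length = ∑ i, a i := by
  rw [leadList, List.length_flatMap, ← List.ofFn_eq_map, List.sum_ofFn]
  simp

theorem lead_mem_filt {r : ℕ} (a : Fin r → ℕ) : lead a ∈ filt r (∑ i, a i + 1) := by
  rw [lead_eq_prod]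
  exact prod_mem_filt (by rw [length_leadList]; omega)

theorem count_leadList {r : ℕ} [BEq (NegIdx r)] [LawfulBEq (NegIdx r)] (a b : Fin r → ℕ)
    (p : NegIdx r) :
    (leadList a).count p + (leadList b).count p = (leadList (a + b)).count p := by
  simp only [leadList]
  induction List.finRange r with
  | nil => simp
  | cons i l ih =>
    simp only [List.flatMap_cons, List.count_append, List.count_replicate, Pi.add_apply] at ih ⊢
    split_ifs <;> omega

theorem leadList_add_perm {r : ℕ} (a b : Fin r → ℕ) :
    (leadList a ++ leadList b).Perm (leadList (a + b)) := by
  refine List.perm_iff_count.2 fun p => ?_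
  rw [List.count_append, count_leadList]

theorem lead_mul_lead {r : ℕ} (a b : Fin r → ℕ) :
    lead a * lead b - lead (a + b) ∈ filt r (∑ i, (a + b) i) := by
  have h := prod_sub_prod_mem_filt (leadList_add_perm a b)
  rwa [List.map_append, List.prod_append, ← lead_eq_prod, ← lead_eq_prod, ← lead_eq_prod,
    List.length_append, length_leadList, length_leadList, ← Finset.sum_add_distrib] at h

/-! ### Operators on functions of a multi-index

A function `q : (Fin (r + 1) → ℕ) → M` stands for the formal sum of the `q b ⊗ x^b / b!`. -/

section Operators

variable {r : ℕ} {M : Type*} [AddCommGroup M] [Module ℂ M]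

variable (r M) in
/-- Functions of a multi-index with values in `M`. -/
abbrev Fun := (Fin (r + 1) → ℕ) → M

/-- Differentiation with respect to `x_j`. -/
def shift (j : Fin (r + 1)) : Module.End ℂ (Fun r M) where
  toFun q b := q (b + Pi.single j 1)
  map_add' _ _ := rfl
  map_smul' _ _ := rfl

/-- Multiplication by `x_j`. -/
def raise (j : Fin (r + 1)) : Module.End ℂ (Fun r M) where
  -- The factor `b j` is due to the divided powers `x^b / b!`; it also kills the junk value of the
  -- truncated subtraction when `b j = 0`.
  toFun q b := (b j : ℂ) • q (b - Pi.single j 1)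
  map_add' _ _ := by
    funext b
    exact smul_add _ _ _
  map_smul' _ _ := by
    funext b
    exact smul_comm _ _ _

theorem shift_comm (i j : Fin (r + 1)) :
    (shift i * shift j : Module.End ℂ (Fun r M)) = shift j * shift i := by
  ext q b
  change q (b + _ + _) = q (b + _ + _)
  rw [add_right_comm]

theorem raise_comm (i j : Fin (r + 1)) :
    (raise i * raise j : Module.End ℂ (Fun r M)) = raise j * raise i := by
  rcases eq_or_ne i j with rfl | h
  · rfl
  ext q b
  change (b i : ℂ) • (((b - Pi.single i 1 : Fin (r + 1) → ℕ) j : ℕ) : ℂ) • q _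
    = (b j : ℂ) • (((b - Pi.single j 1 : Fin (r + 1) → ℕ) i : ℕ) : ℂ) • q _
  have h1 : (b - Pi.single i 1 : Fin (r + 1) → ℕ) j = b j := by simp [h.symm]
  have h2 : (b - Pi.single j 1 : Fin (r + 1) → ℕ) i = b i := by simp [h]
  rw [h1, h2, smul_comm, tsub_right_comm]

theorem shift_raise_of_ne {j k : Fin (r + 1)} (h : j ≠ k) :
    (shift j * raise k : Module.End ℂ (Fun r M)) = raise k * shift j := by
  ext q b
  change ((b + Pi.single j 1 : Fin (r + 1) → ℕ) k : ℂ) • q _ = (b k : ℂ) • q _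
  have h1 : (b + Pi.single j 1 : Fin (r + 1) → ℕ) k = b k := by simp [h.symm]
  rw [h1]
  congr 2
  funext l
  rcases eq_or_ne l j with rfl | hl
  · simp [h]
  · simp [hl]

theorem shift_raise_self (j : Fin (r + 1)) :
    (shift j * raise j : Module.End ℂ (Fun r M)) = raise j * shift j + 1 := by
  ext q b
  change ((b + Pi.single j 1 : Fin (r + 1) → ℕ) j : ℂ) • q (b + Pi.single j 1 - Pi.single j 1)
    = (b j : ℂ) • q (b - Pi.single j 1 + Pi.single j 1) + q b
  have h1 : (b + Pi.single j 1 : Fin (r + 1) → ℕ) j = b j + 1 := by simp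
  rw [h1, add_tsub_cancel_right, Nat.cast_succ, add_smul, one_smul]
  congr 1
  rcases Nat.eq_zero_or_pos (b j) with h | h
  · simp [h]
  · rw [tsub_add_cancel_of_le]
    intro l
    rcases eq_or_ne l j with rfl | hl
    · simpa [Nat.one_le_iff_ne_zero, Nat.pos_iff_ne_zero] using h
    · simp [hl]

theorem shift_raise_pow_self (i : Fin (r + 1)) (a : ℕ) :
    (shift i * raise i ^ (a + 1) : Module.End ℂ (Fun r M))
      = raise i ^ (a + 1) * shift i + ((a : ℂ) + 1) • raise i ^ a := by
  induction a with
  | zero => simp [shift_raise_self]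
  | succ a ih =>
    rw [pow_succ, ← mul_assoc, ih, add_mul, mul_assoc, shift_raise_self, mul_add, ← mul_assoc,
      ← pow_succ, smul_mul_assoc, ← pow_succ, mul_one]
    push_cast
    module

theorem raise_pow_apply_mem {p : Submodule ℂ M} {q : Fun r M} (h : ∀ b, q b ∈ p)
    (i : Fin (r + 1)) (a : ℕ) (b : Fin (r + 1) → ℕ) : (raise i ^ a) q b ∈ p := by
  induction a generalizing b with
  | zero => exact h b
  | succ a ih =>
    rw [pow_succ', Module.End.mul_apply]
    exact Submodule.smul_mem _ _ (ih _)

theorem raise_apply_zero (i : Fin (r + 1)) (q : Fun r M) : raise i q 0 = 0 := by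
  change ((0 : ℕ) : ℂ) • _ = (0 : M)
  rw [Nat.cast_zero, zero_smul]

theorem shift_single_zero (j : Fin (r + 1)) (y : M) : shift j (Pi.single 0 y : Fun r M) = 0 := by
  funext b
  refine Pi.single_eq_of_ne (fun h => ?_) _
  simpa using congrFun h j

/-- The functions that vanish on multi-indices of degree at least `d`. -/
def van (r : ℕ) (M : Type*) [AddCommGroup M] [Module ℂ M] (d : ℕ) : Submodule ℂ (Fun r M) where
  carrier := {q | ∀ b, d ≤ ∑ i, b i → q b = 0}
  add_mem' hx hy b hb := by
    rw [Pi.add_apply, hx b hb, hy b hb, add_zero]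
  zero_mem' _ _ := rfl
  smul_mem' c x hx b hb := by
    rw [Pi.smul_apply, hx b hb, smul_zero]

theorem eq_zero_of_mem_van_zero {q : Fun r M} (h : q ∈ van r M 0) : q = 0 :=
  funext fun b => h b (Nat.zero_le _)

theorem shift_mem_van {d : ℕ} {q : Fun r M} (h : q ∈ van r M (d + 1)) (j : Fin (r + 1)) :
    shift j q ∈ van r M d := by
  intro b hb
  refine h _ ?_
  simp only [Pi.add_apply, Finset.sum_add_distrib, Finset.sum_pi_single', Finset.mem_univ, if_true]
  omega

theorem raise_mem_van {d : ℕ} {q : Fun r M} (h : q ∈ van r M d) (j : Fin (r + 1)) :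
    raise j q ∈ van r M (d + 1) := by
  intro b hb
  change (b j : ℂ) • q (b - Pi.single j 1) = 0
  rcases Nat.eq_zero_or_pos (b j) with h0 | h0
  · simp [h0]
  rw [h, smul_zero]
  have h1 : b - Pi.single j 1 + Pi.single j 1 = b := by
    refine tsub_add_cancel_of_le fun l => ?_
    rcases eq_or_ne l j with rfl | hl
    · simpa [Nat.one_le_iff_ne_zero, Nat.pos_iff_ne_zero] using h0
    · simp [hl]
  rw [← h1] at hb
  simp only [Pi.add_apply, Finset.sum_add_distrib, Finset.sum_pi_single', Finset.mem_univ,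
    if_true] at hb
  omega

theorem raise_pow_mem_van {d a : ℕ} {q : Fun r M} (h : q ∈ van r M d) (i : Fin (r + 1)) :
    (raise i ^ a) q ∈ van r M (d + a) := by
  induction a with
  | zero => exact h
  | succ a ih =>
    rw [pow_succ', Module.End.mul_apply]
    exact raise_mem_van ih i

/-! ### Operators mixing the action on `M` with derivatives -/

variable [Module (U r) M] [IsScalarTower ℂ (U r) M]

/-- The action of the matrix unit `E_{i,j}` on the values of a function. -/
def act (i j : Fin (r + 1)) : Module.End ℂ (Fun r M) := Algebra.lsmul ℂ ℂ (Fun r M) (unit i j)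

theorem act_apply (i j : Fin (r + 1)) (q : Fun r M) (b : Fin (r + 1) → ℕ) :
    act i j q b = (unit i j : U r) • q b := rfl

theorem act_shift (i j k : Fin (r + 1)) :
    (act i j * shift k : Module.End ℂ (Fun r M)) = shift k * act i j := rfl

theorem act_raise (i j k : Fin (r + 1)) :
    (act i j * raise k : Module.End ℂ (Fun r M)) = raise k * act i j := by
  ext q b
  change (unit i j : U r) • ((b k : ℂ) • q _) = (b k : ℂ) • (unit i j : U r) • q _
  rw [← algebraMap_smul (U r) (b k : ℂ), ← algebraMap_smul (U r) (b k : ℂ), smul_smul, smul_smul,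
    Algebra.commutes]

theorem act_mul_act (i j k l : Fin (r + 1)) :
    (act i j * act k l : Module.End ℂ (Fun r M)) = act k l * act i j
      + (if j = k then act i l else 0) - (if l = i then act k j else 0) := by
  simp only [act]
  rw [← map_mul, unit_mul_unit, map_sub, map_add, map_mul, apply_ite (Algebra.lsmul ℂ ℂ (Fun r M)),
    apply_ite (Algebra.lsmul ℂ ℂ (Fun r M)), map_zero]

/-- The operator `∑_{j > i} E_{j,i} ∂_j`. -/
def lower (i : Fin (r + 1)) : Module.End ℂ (Fun r M) :=
  ∑ j ∈ Finset.Ioi i, act j i * shift j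

theorem shift_lower (i k : Fin (r + 1)) :
    (shift k * lower i : Module.End ℂ (Fun r M)) = lower i * shift k := by
  rw [lower, Finset.mul_sum, Finset.sum_mul]
  refine Finset.sum_congr rfl fun j _ => ?_
  rw [← mul_assoc, ← act_shift, mul_assoc, shift_comm, mul_assoc]

theorem raise_lower_of_le {i k : Fin (r + 1)} (h : k ≤ i) :
    (raise k * lower i : Module.End ℂ (Fun r M)) = lower i * raise k := by
  rw [lower, Finset.mul_sum, Finset.sum_mul]
  refine Finset.sum_congr rfl fun j hj => ?_
  rw [← mul_assoc, ← act_raise, mul_assoc,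
    ← shift_raise_of_ne (h.trans_lt (Finset.mem_Ioi.1 hj)).ne', mul_assoc]

theorem raise_lower_of_lt {i k : Fin (r + 1)} (h : i < k) :
    (raise k * lower i : Module.End ℂ (Fun r M)) = lower i * raise k - act k i := by
  rw [lower, Finset.mul_sum, Finset.sum_mul, eq_sub_iff_add_eq]
  rw [← Finset.add_sum_erase _ _ (Finset.mem_Ioi.2 h), ← Finset.add_sum_erase (Finset.Ioi i)
    (fun j => act j i * shift j * raise k) (Finset.mem_Ioi.2 h)]
  have h1 : (∑ j ∈ (Finset.Ioi i).erase k, raise k * (act j i * shift j) :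
      Module.End ℂ (Fun r M)) = ∑ j ∈ (Finset.Ioi i).erase k, act j i * shift j * raise k := by
    refine Finset.sum_congr rfl fun j hj => ?_
    rw [← mul_assoc, ← act_raise, mul_assoc, ← shift_raise_of_ne (Finset.ne_of_mem_erase hj),
      mul_assoc]
  rw [h1, ← mul_assoc, ← act_raise, mul_assoc (act k i), mul_assoc (act k i), shift_raise_self,
    mul_add, mul_one]
  abel

theorem act_lower (a b i : Fin (r + 1)) :
    (act a b * lower i : Module.End ℂ (Fun r M)) = lower i * act a b
      + (if i < b then act a i * shift b else 0)
      - (if i = a then ∑ j ∈ Finset.Ioi i, act j b * shift j else 0) := by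
  have h : ∀ j, (act a b * (act j i * shift j) : Module.End ℂ (Fun r M))
      = act j i * shift j * act a b + (if b = j then act a i * shift j else 0)
        - (if i = a then act j b * shift j else 0) := by
    intro j
    rw [← mul_assoc, act_mul_act, sub_mul, add_mul, mul_assoc, act_shift, ← mul_assoc, ite_mul,
      ite_mul, zero_mul]
  rw [lower, Finset.mul_sum, Finset.sum_congr rfl fun j _ => h j, Finset.sum_sub_distrib,
    Finset.sum_add_distrib, Finset.sum_mul, Finset.sum_ite_eq]
  congr 2
  · simp
  · split_ifs <;> simp

/-- The operator `∑_{j ≥ k} E_{j,k} ∂_j`. -/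
def lowerDiag (k : Fin (r + 1)) : Module.End ℂ (Fun r M) :=
  ∑ j ∈ Finset.Ici k, act j k * shift j

theorem lowerDiag_eq (k : Fin (r + 1)) :
    (lowerDiag k : Module.End ℂ (Fun r M)) = lower k + act k k * shift k := by
  have h : Finset.Ici k = insert k (Finset.Ioi k) := (Finset.Ioi_insert k).symm
  rw [lowerDiag, lower, h, Finset.sum_insert (by simp), add_comm (act k k * shift k)]

theorem Ioi_castSucc (i : Fin r) : Finset.Ioi i.castSucc = Finset.Ici i.succ := by
  ext j
  simp [Fin.castSucc_lt_iff_succ_le]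

theorem lowerDiag_lower (i : Fin r) :
    (lowerDiag i.succ * lower i.castSucc : Module.End ℂ (Fun r M))
      = lower i.castSucc * lowerDiag i.succ + lower i.castSucc * shift i.succ := by
  conv_rhs => rw [lowerDiag]
  conv_rhs => arg 2; rw [lower]
  rw [lowerDiag, Ioi_castSucc, Finset.sum_mul, Finset.mul_sum, Finset.sum_mul,
    ← Finset.sum_add_distrib]
  refine Finset.sum_congr rfl fun j hj => ?_
  have hj' : i.castSucc < j := Fin.castSucc_lt_iff_succ_le.2 (Finset.mem_Ici.1 hj)
  rw [mul_assoc, shift_lower, ← mul_assoc, act_lower, if_pos Fin.castSucc_lt_succ,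
    if_neg hj'.ne, sub_zero, add_mul, mul_assoc, mul_assoc, mul_assoc, shift_comm]

theorem act_diag_lower (i : Fin (r + 1)) :
    (act i i * lower i : Module.End ℂ (Fun r M)) = lower i * act i i - lower i := by
  rw [act_lower, if_neg (lt_irrefl i), add_zero, if_pos rfl, ← lower]

/-- The commutator of `E_{i,i+1}` with `D_i` has two pieces. On an `E_{i,i}`-eigenvector for which
`lowerDiag i.succ` acts as a scalar times `∂_{i+1}`, both become multiples of `∂_{i+1}`; this is why
chains carry that relation. -/
theorem act_succ_lower (i : Fin r) :
    (act i.castSucc i.succ * lower i.castSucc : Module.End ℂ (Fun r M))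
      = lower i.castSucc * act i.castSucc i.succ + act i.castSucc i.castSucc * shift i.succ
        - lowerDiag i.succ := by
  rw [act_lower, if_pos Fin.castSucc_lt_succ, if_pos rfl, lowerDiag, Ioi_castSucc]

theorem act_lower_of_lt {a b i : Fin (r + 1)} (h : a < i) (h' : b ≤ i) :
    (act a b * lower i : Module.End ℂ (Fun r M)) = lower i * act a b := by
  rw [act_lower, if_neg h'.not_gt, if_neg h.ne', add_zero, sub_zero]

/-- The action of the simple root vector `E_{k,k+1}` on `M`-valued polynomials. -/
def total (k : Fin r) : Module.End ℂ (Fun r M) :=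
  raise k.castSucc * shift k.succ + act k.castSucc k.succ

/-- `D_i` contracts the vector `(E_{j,i})_{j>i}` with the dual vector `(∂_j)_{j>i}`, so it is
invariant under the matrix units with both indices above `i`. -/
theorem total_lower {i : Fin (r + 1)} {k : Fin r} (h : i < k.castSucc) :
    (total k * lower i : Module.End ℂ (Fun r M)) = lower i * total k := by
  have h' : i < k.succ := h.trans Fin.castSucc_lt_succ
  rw [total, add_mul, mul_assoc, shift_lower, ← mul_assoc, raise_lower_of_lt h, act_lower,
    if_pos h', if_neg h.ne, sub_zero, sub_mul, mul_add, mul_assoc]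
  abel

theorem act_mem_van {d : ℕ} {q : Fun r M} (h : q ∈ van r M d) (i j : Fin (r + 1)) :
    act i j q ∈ van r M d := by
  intro b hb
  rw [act_apply, h b hb, smul_zero]

theorem lower_mem_van {d : ℕ} {q : Fun r M} (h : q ∈ van r M (d + 1)) (i : Fin (r + 1)) :
    lower i q ∈ van r M d := by
  rw [lower, LinearMap.sum_apply]
  exact Submodule.sum_mem _ fun j _ => act_mem_van (shift_mem_van h j) _ _

theorem lower_pow_mem_van {d a : ℕ} {q : Fun r M} (h : q ∈ van r M (d + a)) (i : Fin (r + 1)) :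
    (lower i ^ a) q ∈ van r M d := by
  induction a generalizing d with
  | zero => exact h
  | succ a ih =>
    rw [pow_succ', Module.End.mul_apply]
    exact lower_mem_van (ih (by rwa [add_assoc, add_comm 1])) i

end Operators

/-! ### A chain of partially singular functions -/

section Chain

variable {r : ℕ} {M : Type*} [AddCommGroup M] [Module ℂ M] [Module (U r) M]
  [IsScalarTower ℂ (U r) M]

theorem act_diag_lower_pow {i : Fin (r + 1)} {z : ℂ} {q : Fun r M} (h : act i i q = z • q)
    (a : ℕ) : act i i ((lower i ^ a) q) = (z - a) • (lower i ^ a) q := by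
  induction a with
  | zero => simpa using h
  | succ a ih =>
    rw [pow_succ', Module.End.mul_apply, ← Module.End.mul_apply, act_diag_lower,
      LinearMap.sub_apply, Module.End.mul_apply, ih, map_smul]
    push_cast
    module

theorem lowerDiag_lower_pow {i : Fin r} {c : ℂ} {q : Fun r M}
    (h : lowerDiag i.succ q = c • shift i.succ q) (a : ℕ) :
    lowerDiag i.succ ((lower i.castSucc ^ a) q)
      = (c + a) • (lower i.castSucc ^ a) (shift i.succ q) := by
  induction a with
  | zero => simpa using h
  | succ a ih =>
    have h1 : shift i.succ ((lower i.castSucc ^ a) q)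
        = (lower i.castSucc ^ a) (shift i.succ q) := by
      rw [← Module.End.mul_apply, ← Module.End.mul_apply]
      congr 1
      exact Commute.pow_right (shift_lower _ _) a
    rw [pow_succ', Module.End.mul_apply, ← Module.End.mul_apply, lowerDiag_lower,
      LinearMap.add_apply, Module.End.mul_apply, ih, map_smul, Module.End.mul_apply,
      Module.End.mul_apply, h1]
    push_cast
    module

/-- As in the `sl(2)` formula for `e f^(a+1)`: the passage over the successive factors `D_i`
contributes `z - c - 2b` for `b = 0, …, a`. -/
theorem act_succ_lower_pow {i : Fin r} {z c : ℂ} {q : Fun r M}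
    (hq : act i.castSucc i.succ q = 0) (hz : act i.castSucc i.castSucc q = z • q)
    (hc : lowerDiag i.succ q = c • shift i.succ q) (a : ℕ) :
    act i.castSucc i.succ ((lower i.castSucc ^ (a + 1)) q)
      = (((a : ℂ) + 1) * (z - a - c)) • (lower i.castSucc ^ a) (shift i.succ q) := by
  have h1 : ∀ a : ℕ, act i.castSucc i.castSucc (shift i.succ ((lower i.castSucc ^ a) q))
        = (z - a) • (lower i.castSucc ^ a) (shift i.succ q) := by
    intro a
    rw [← Module.End.mul_apply, act_shift, Module.End.mul_apply, act_diag_lower_pow hz, map_smul,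
      ← Module.End.mul_apply, ← Module.End.mul_apply]
    congr 2
    exact Commute.pow_right (shift_lower _ _) a
  induction a with
  | zero =>
    have := h1 0
    rw [Nat.cast_zero, pow_zero, Module.End.one_apply, Module.End.one_apply] at this
    rw [zero_add, pow_one, pow_zero, Module.End.one_apply, ← Module.End.mul_apply, act_succ_lower,
      LinearMap.sub_apply, LinearMap.add_apply, Module.End.mul_apply, Module.End.mul_apply, hq,
      map_zero, this, hc]
    push_cast
    module
  | succ a ih =>
    rw [pow_succ', Module.End.mul_apply, ← Module.End.mul_apply, act_succ_lower,
      LinearMap.sub_apply, LinearMap.add_apply, Module.End.mul_apply, Module.End.mul_apply, ih,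
      map_smul, h1, lowerDiag_lower_pow hc, ← Module.End.mul_apply, ← pow_succ']
    push_cast
    module

/-- The sum `∑_{a ≤ m} t_a x_i^a D_i^a q`. -/
def step (t : ℕ → ℂ) (m : ℕ) (i : Fin (r + 1)) (q : Fun r M) : Fun r M :=
  ∑ a ∈ Finset.range (m + 1), t a • (raise i ^ a) ((lower i ^ a) q)

/-- Because `x_i` and `D_i` commute, `step` is a polynomial in `x_i D_i` applied to `q`. -/
theorem step_eigen {Z : Module.End ℂ (Fun r M)} {t : ℕ → ℂ} {m : ℕ} {i : Fin (r + 1)}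
    {q : Fun r M} {z : ℂ} (hZ : Commute Z (raise i * lower i)) (h : Z q = z • q) :
    Z (step t m i q) = z • step t m i q := by
  have hc : Commute (raise i) (lower i : Module.End ℂ (Fun r M)) := raise_lower_of_le le_rfl
  rw [step, map_sum, Finset.smul_sum]
  refine Finset.sum_congr rfl fun a _ => ?_
  rw [map_smul, ← Module.End.mul_apply (raise i ^ a), ← hc.mul_pow, ← Module.End.mul_apply,
    (hZ.pow_right a).eq, Module.End.mul_apply, h, map_smul, smul_comm]

theorem step_eq_zero {Z : Module.End ℂ (Fun r M)} {t : ℕ → ℂ} {m : ℕ} {i : Fin (r + 1)}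
    {q : Fun r M} (hZ : Commute Z (raise i * lower i)) (h : Z q = 0) :
    Z (step t m i q) = 0 := by
  rw [step_eigen (z := 0) hZ (by rw [h, zero_smul]), zero_smul]

/-- The operator whose eigenvalue is the weight with respect to `E_{l,l}`. -/
def number (l : Fin (r + 1)) : Module.End ℂ (Fun r M) := act l l + raise l * shift l

theorem number_lower_of_ne {i l : Fin (r + 1)} (h : l ≠ i) :
    Commute (number l : Module.End ℂ (Fun r M)) (lower i) := by
  rcases lt_or_gt_of_ne h with h | h
  · refine Commute.add_left (act_lower_of_lt h h.le) (Commute.mul_left ?_ (shift_lower _ _))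
    exact raise_lower_of_le h.le
  · rw [Commute, SemiconjBy, number, add_mul, mul_assoc, shift_lower, ← mul_assoc,
      raise_lower_of_lt h, act_lower, if_pos h, if_neg h.ne, sub_zero, sub_mul, mul_add, mul_assoc]
    abel

theorem number_lower_self (i : Fin (r + 1)) :
    (number i * lower i : Module.End ℂ (Fun r M)) = lower i * number i - lower i := by
  rw [number, add_mul, act_diag_lower, mul_assoc, shift_lower, ← mul_assoc,
    raise_lower_of_le le_rfl, mul_add, mul_assoc]
  abel

theorem number_raise_of_ne {i l : Fin (r + 1)} (h : l ≠ i) :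
    Commute (number l : Module.End ℂ (Fun r M)) (raise i) :=
  Commute.add_left (act_raise _ _ _) (Commute.mul_left (raise_comm _ _) (shift_raise_of_ne h))

theorem number_raise_self (i : Fin (r + 1)) :
    (number i * raise i : Module.End ℂ (Fun r M)) = raise i * number i + raise i := by
  rw [number, add_mul, act_raise, mul_assoc, shift_raise_self, mul_add, mul_add, mul_one]
  abel

theorem number_raise_lower (i l : Fin (r + 1)) :
    Commute (number l : Module.End ℂ (Fun r M)) (raise i * lower i) := by
  rcases eq_or_ne l i with rfl | h
  · rw [Commute, SemiconjBy, ← mul_assoc, number_raise_self, add_mul, mul_assoc,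
      number_lower_self, mul_sub, mul_assoc]
    abel
  · exact (number_raise_of_ne h).mul_right (number_lower_of_ne h)

/-- The function `q` is a highest weight vector, of degree at most `m` in the variables
`x_i, …, x_q`, for the subalgebra with indices at least `i`. -/
structure IsChain (lam : Fin (r + 1) → ℂ) (c : ℂ) (m : ℕ) (top i : Fin (r + 1)) (q : Fun r M) :
    Prop where
  shift_eq : ∀ l < i, shift l q = 0
  total_eq : ∀ k : Fin r, i ≤ k.castSucc → total k q = 0
  act_eq : ∀ k : Fin r, k.castSucc < i → act k.castSucc k.succ q = 0
  number_eq : ∀ l, number l q = (lam l + if l = top then (m : ℂ) else 0) • q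
  -- A Casimir-type eigenvalue relation; its constant enters the recursion for the coefficients of
  -- the next step.
  casimir : lowerDiag i q = c • shift i q
  mem_van : q ∈ van r M (m + 1)

theorem IsChain.act_diag {lam : Fin (r + 1) → ℂ} {c : ℂ} {m : ℕ} {top i : Fin (r + 1)}
    {q : Fun r M} (h : IsChain lam c m top i q) {l : Fin (r + 1)} (hl : l < i) (ht : i ≤ top) :
    act l l q = lam l • q := by
  have := h.number_eq l
  rwa [number, LinearMap.add_apply, Module.End.mul_apply, h.shift_eq l hl, map_zero, add_zero,
    if_neg (hl.trans_le ht).ne, add_zero] at this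

/-- Both `x_i ∂_{i+1}` on term `a` and `E_{i,i+1}` on term `a + 1` give multiples of `x_i^(a+1)
D_i^a ∂_{i+1} q`; the recursion for `t` makes them cancel. -/
theorem total_step {lam : Fin (r + 1) → ℂ} {c : ℂ} {m : ℕ} {top : Fin (r + 1)} {i : Fin r}
    {q : Fun r M} (h : IsChain lam c m top i.succ q) (ht : i.succ ≤ top) {t : ℕ → ℂ}
    (h_t : ∀ a < m, t a = t (a + 1) * (a + 1) * (c - lam i.castSucc + a)) :
    total i (step t m i.castSucc q) = 0 := by
  have hi : i.castSucc < i.succ := Fin.castSucc_lt_succ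
  have hs : ∀ a, shift i.succ ((raise i.castSucc ^ a) ((lower i.castSucc ^ a) q))
      = (raise i.castSucc ^ a) ((lower i.castSucc ^ a) (shift i.succ q)) := by
    intro a
    simp only [← Module.End.mul_apply]
    congr 1
    exact Commute.mul_right (Commute.pow_right (shift_raise_of_ne hi.ne') a)
      (Commute.pow_right (shift_lower _ _) a)
  have he : ∀ a, act i.castSucc i.succ ((raise i.castSucc ^ a) ((lower i.castSucc ^ a) q))
      = (raise i.castSucc ^ a) (act i.castSucc i.succ ((lower i.castSucc ^ a) q)) := by
    intro a
    rw [← Module.End.mul_apply, ← Module.End.mul_apply (raise i.castSucc ^ a)]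
    congr 1
    exact Commute.pow_right (act_raise _ _ _) a
  -- The last term of `x_i ∂_{i+1}` has no partner, but it involves `m + 1` derivatives of a
  -- function of degree at most `m`.
  have hv : (lower i.castSucc ^ m) (shift i.succ q) = 0 :=
    eq_zero_of_mem_van_zero (lower_pow_mem_van (d := 0)
      (by rw [zero_add]; exact shift_mem_van h.mem_van _) _)
  rw [total, LinearMap.add_apply, Module.End.mul_apply, step, map_sum, map_sum, map_sum,
    Finset.sum_range_succ, Finset.sum_range_succ', map_smul, hs, hv, map_zero, smul_zero, map_zero,
    add_zero, map_smul, he, pow_zero, pow_zero, Module.End.one_apply, Module.End.one_apply,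
    h.act_eq i hi, smul_zero, add_zero, ← Finset.sum_add_distrib]
  refine Finset.sum_eq_zero fun a ha => ?_
  rw [map_smul, map_smul, map_smul, hs, he, act_succ_lower_pow (h.act_eq i hi)
    (h.act_diag hi ht) h.casimir, map_smul, ← Module.End.mul_apply (raise i.castSucc), ← pow_succ',
    h_t a (Finset.mem_range.1 ha)]
  module

/-- Term by term, `D_i` contributes `c - λ_i + a` by the recursion and `E_{i,i}` contributes `λ_i -
a - 1`; their sum `c - 1` does not depend on `a`. -/
theorem casimir_step {lam : Fin (r + 1) → ℂ} {c : ℂ} {m : ℕ} {top : Fin (r + 1)} {i : Fin r}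
    {q : Fun r M} (h : IsChain lam c m top i.succ q) (ht : i.succ ≤ top) {t : ℕ → ℂ}
    (h_t : ∀ a < m, t a = t (a + 1) * (a + 1) * (c - lam i.castSucc + a)) :
    lowerDiag i.castSucc (step t m i.castSucc q)
      = (c - 1) • shift i.castSucc (step t m i.castSucc q) := by
  have hi : i.castSucc < i.succ := Fin.castSucc_lt_succ
  have hq : ∀ a, shift i.castSucc ((lower i.castSucc ^ a) q) = 0 := by
    intro a
    rw [← Module.End.mul_apply, (Commute.pow_right (shift_lower _ _) a : Commute _ _).eq,
      Module.End.mul_apply, h.shift_eq _ hi, map_zero]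
  have hs : shift i.castSucc (step t m i.castSucc q) = ∑ a ∈ Finset.range m,
      (t (a + 1) * (a + 1)) • (raise i.castSucc ^ a) ((lower i.castSucc ^ (a + 1)) q) := by
    rw [step, map_sum, Finset.sum_range_succ', pow_zero, pow_zero, map_smul, Module.End.one_apply,
      Module.End.one_apply, h.shift_eq _ hi, smul_zero, add_zero]
    refine Finset.sum_congr rfl fun a _ => ?_
    rw [map_smul, ← Module.End.mul_apply (shift i.castSucc), shift_raise_pow_self,
      LinearMap.add_apply, Module.End.mul_apply, hq, map_zero, zero_add, LinearMap.smul_apply,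
      smul_smul]
  have hl : lower i.castSucc (step t m i.castSucc q) = ∑ a ∈ Finset.range m,
      t a • (raise i.castSucc ^ a) ((lower i.castSucc ^ (a + 1)) q) := by
    have hv : (lower i.castSucc ^ (m + 1)) q = 0 :=
      eq_zero_of_mem_van_zero (lower_pow_mem_van (d := 0)
        (by rw [zero_add]; exact h.mem_van) _)
    have hl' : ∀ a, lower i.castSucc ((raise i.castSucc ^ a) ((lower i.castSucc ^ a) q))
        = (raise i.castSucc ^ a) ((lower i.castSucc ^ (a + 1)) q) := by
      intro a
      rw [pow_succ', Module.End.mul_apply, ← Module.End.mul_apply,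
        ← Module.End.mul_apply (raise i.castSucc ^ a)]
      congr 1
      exact Commute.pow_right (raise_lower_of_le le_rfl).symm a
    rw [step, map_sum, Finset.sum_range_succ, map_smul, hl', hv, map_zero, smul_zero, add_zero]
    exact Finset.sum_congr rfl fun a _ => by rw [map_smul, hl']
  rw [lowerDiag_eq, LinearMap.add_apply, Module.End.mul_apply, hs, hl, map_sum,
    ← Finset.sum_add_distrib, Finset.smul_sum]
  refine Finset.sum_congr rfl fun a ha => ?_
  rw [map_smul, ← Module.End.mul_apply (act i.castSucc i.castSucc),
    (Commute.pow_right (act_raise _ _ _) a : Commute _ _).eq, Module.End.mul_apply,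
    act_diag_lower_pow (h.act_diag hi ht), map_smul, h_t a (Finset.mem_range.1 ha)]
  push_cast
  module

theorem isChain_step {lam : Fin (r + 1) → ℂ} {c : ℂ} {m : ℕ} {top : Fin (r + 1)} {i : Fin r}
    {q : Fun r M} (h : IsChain lam c m top i.succ q) (ht : i.succ ≤ top) {t : ℕ → ℂ}
    (h_t : ∀ a < m, t a = t (a + 1) * (a + 1) * (c - lam i.castSucc + a)) :
    IsChain lam (c - 1) m top i.castSucc (step t m i.castSucc q) where
  shift_eq l hl := by
    refine step_eq_zero (Commute.mul_right (shift_raise_of_ne hl.ne) (shift_lower _ _))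
      (h.shift_eq l (hl.trans Fin.castSucc_lt_succ))
  total_eq k hk := by
    rcases hk.eq_or_lt with hk | hk
    · obtain rfl : i = k := Fin.castSucc_injective _ hk
      exact total_step h ht h_t
    · refine step_eq_zero (Commute.mul_right (Commute.add_left ?_ (act_raise _ _ _))
        (total_lower hk)) (h.total_eq k (Fin.castSucc_lt_iff_succ_le.1 hk))
      exact Commute.mul_left (raise_comm _ _)
        (shift_raise_of_ne (hk.trans Fin.castSucc_lt_succ).ne')
  act_eq k hk := by
    refine step_eq_zero (Commute.mul_right (act_raise _ _ _)
      (act_lower_of_lt hk (Fin.castSucc_lt_iff_succ_le.1 hk)))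
      (h.act_eq k (hk.trans Fin.castSucc_lt_succ))
  number_eq l := step_eigen (number_raise_lower _ _) (h.number_eq l)
  casimir := casimir_step h ht h_t
  mem_van := by
    refine Submodule.sum_mem _ fun a ha => Submodule.smul_mem _ _ ?_
    have ha' : m + 1 - a + a = m + 1 := by
      have := Finset.mem_range.1 ha
      omega
    rw [← ha']
    exact raise_pow_mem_van (lower_pow_mem_van (by rw [ha']; exact h.mem_van) _) _

end Chain

/-! ### Highest weight vectors -/

/-- The element of the Cartan subalgebra obtained from the matrix unit `E_{l,l}`. -/
def hdiag {r : ℕ} (l : Fin (r + 1)) : cartan r :=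
  ⟨traceFree r (Matrix.single l l 1), fun i j h => by
    have : Matrix.single l l (1 : ℂ) i j = 0 :=
      Matrix.single_apply_of_ne _ _ _ _ _ (fun hk => h (hk.1.symm.trans hk.2))
    change Matrix.single l l (1 : ℂ) i j - (_ • (1 : Matrix (Fin (r + 1)) (Fin (r + 1)) ℂ)) i j = 0
    rw [this, Matrix.smul_apply, Matrix.one_apply_ne h, smul_zero, sub_zero]⟩

theorem cartan_eq_sum {r : ℕ} (H : cartan r) : H = ∑ l, H.1.1 l l • hdiag l := by
  apply Subtype.ext
  rw [AddSubmonoidClass.coe_finsetSum]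
  change H.1 = ∑ l, H.1.1 l l • traceFree r (Matrix.single l l 1)
  simp_rw [← map_smul]
  rw [← map_sum]
  conv_lhs => rw [← traceFree_coe H.1]
  congr 1
  conv_lhs => rw [Matrix.matrix_eq_sum_single H.1.1]
  refine Finset.sum_congr rfl fun i _ => ?_
  rw [Finset.sum_eq_single i]
  · simp
  · intro j _ hj
    rw [H.2 i j hj.symm, Matrix.single_zero]
  · simp

theorem coroot_eq {r : ℕ} (β : PosRoot r) : coroot β = hdiag β.1.1 - hdiag β.1.2 := by
  apply Subtype.ext
  change LieAlgebra.SpecialLinear.singleSubSingle β.1.1 β.1.2 (1 : ℂ)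
    = traceFree r (Matrix.single β.1.1 β.1.1 1) - traceFree r (Matrix.single β.1.2 β.1.2 1)
  rw [← map_sub, ← traceFree_coe (LieAlgebra.SpecialLinear.singleSubSingle β.1.1 β.1.2 (1 : ℂ))]
  rfl

theorem root_hdiag {r : ℕ} (β : PosRoot r) (l : Fin (r + 1)) :
    root β (hdiag l) = (if l = β.1.1 then 1 else 0) - (if l = β.1.2 then 1 else 0) := by
  have h : ∀ k : Fin (r + 1), e k (hdiag l) = (if l = k then 1 else 0)
      - (Matrix.single l l (1 : ℂ)).trace / (r + 1 : ℂ) := by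
    intro k
    change Matrix.single l l (1 : ℂ) k k - (_ • (1 : Matrix (Fin (r + 1)) (Fin (r + 1)) ℂ)) k k = _
    simp [Matrix.single_apply]
  rw [root, LinearMap.sub_apply, h, h]
  ring

/-- With indices from `0`, `e k` occurs `r - k` times with sign plus and `k` times with sign minus
among the positive roots. -/
theorem rho_eq {r : ℕ} : rho r = ∑ k : Fin (r + 1), ((r : ℂ) / 2 - k) • e k := by
  have h1 : ∑ β : PosRoot r, root β
      = ∑ i : Fin (r + 1), ∑ j : Fin (r + 1), if i < j then (e i - e j : Wt r) else 0 := by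
    rw [← Fintype.sum_prod_type', ← Finset.sum_filter]
    refine (Finset.sum_subtype (Finset.univ.filter fun p : Fin (r + 1) × Fin (r + 1) => p.1 < p.2)
      (by simp) (fun p => (e p.1 - e p.2 : Wt r))).symm
  have h2 : ∀ i j : Fin (r + 1), (if i < j then (e i - e j : Wt r) else 0)
      = (if i < j then e i else 0) - (if i < j then e j else 0) := by
    intro i j
    split_ifs <;> simp
  have h3 : ∑ i : Fin (r + 1), ∑ j : Fin (r + 1), (if i < j then (e i : Wt r) else 0)
      = ∑ k : Fin (r + 1), ((r : ℂ) - k) • e k := by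
    refine Finset.sum_congr rfl fun i _ => ?_
    rw [← Finset.sum_filter, Finset.sum_const, Finset.filter_lt_eq_Ioi, Fin.card_Ioi,
      ← Nat.cast_smul_eq_nsmul ℂ, Nat.add_sub_cancel, Nat.cast_sub (Nat.le_of_lt_succ i.2)]
  have h4 : ∑ i : Fin (r + 1), ∑ j : Fin (r + 1), (if i < j then (e j : Wt r) else 0)
      = ∑ k : Fin (r + 1), (k : ℂ) • e k := by
    rw [Finset.sum_comm]
    refine Finset.sum_congr rfl fun j _ => ?_
    rw [← Finset.sum_filter, Finset.sum_const, Finset.filter_gt_eq_Iio, Fin.card_Iio,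
      ← Nat.cast_smul_eq_nsmul ℂ]
  rw [rho, h1]
  simp_rw [h2, Finset.sum_sub_distrib]
  rw [h3, h4, ← Finset.sum_sub_distrib, Finset.smul_sum]
  refine Finset.sum_congr rfl fun k _ => ?_
  rw [← sub_smul, smul_smul]
  congr 1
  ring

theorem rho_coroot {r : ℕ} (β : PosRoot r) :
    rho r (coroot β) = (β.1.2 : ℂ) - (β.1.1 : ℂ) := by
  have h : ∀ k : Fin (r + 1), e k (coroot β)
      = (if k = β.1.1 then 1 else 0) - (if k = β.1.2 then 1 else 0) := by
    intro k
    change Matrix.single β.1.1 β.1.1 (1 : ℂ) k k - Matrix.single β.1.2 β.1.2 (1 : ℂ) k k = _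
    simp [Matrix.single_apply, eq_comm]
  rw [rho_eq, LinearMap.sum_apply]
  simp_rw [LinearMap.smul_apply, h, smul_eq_mul, mul_sub, mul_ite, mul_one, mul_zero]
  rw [Finset.sum_sub_distrib, Finset.sum_ite_eq', Finset.sum_ite_eq']
  simp

/-- Simple root vectors generate `𝔫`: `E_{i,k+1}` is the commutator of `E_{i,k}` and `E_{k,k+1}`. -/
theorem unit_smul_eq_zero {r : ℕ} {M : Type*} [AddCommGroup M] [Module (U r) M] {v : M}
    (h : ∀ k : Fin r, (unit k.castSucc k.succ : U r) • v = 0)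
    {i j : Fin (r + 1)} (hij : i < j) : (unit i j : U r) • v = 0 := by
  induction j using Fin.induction with
  | zero => exact absurd hij (Fin.not_lt_zero _)
  | succ k ih =>
    rcases (Fin.le_castSucc_iff.2 hij).eq_or_lt with rfl | hk
    · exact h k
    · have := unit_mul_unit i k.castSucc k.castSucc k.succ
      rw [if_pos rfl, if_neg hij.ne', sub_zero] at this
      rw [← sub_eq_iff_eq_add'.2 this, sub_smul, mul_smul, mul_smul, h k, ih hk, smul_zero,
        smul_zero, sub_zero]

section Singular

variable {r : ℕ} {M : Type*} [AddCommGroup M] [Module ℂ M] [Module (U r) M]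

/-- The vector `v` is zero or singular of weight `lam`. -/
def IsHighest (lam : Wt r) (v : M) : Prop :=
  (∀ x : nilp r, UniversalEnvelopingAlgebra.ι ℂ (x : SL r) • v = 0) ∧
    ∀ H : cartan r, UniversalEnvelopingAlgebra.ι ℂ (H : SL r) • v = lam H • v

theorem IsHighest.unit_smul {lam : Wt r} {v : M} (h : IsHighest lam v) {i j : Fin (r + 1)}
    (hij : i < j) : (unit i j : U r) • v = 0 := by
  refine h.1 ⟨traceFree r (Matrix.single i j 1), fun k l hkl => ?_⟩
  rw [traceFree_single hij.ne]
  refine Matrix.single_apply_of_ne _ _ _ _ _ fun hk => ?_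
  rw [hk.1, hk.2] at hij
  exact hkl.not_gt hij

theorem IsHighest.unit_diag_smul {lam : Wt r} {v : M} (h : IsHighest lam v) (l : Fin (r + 1)) :
    (unit l l : U r) • v = lam (hdiag l) • v :=
  h.2 (hdiag l)

theorem isHighest_of_unit [IsScalarTower ℂ (U r) M] {mu : Wt r} {v : M}
    (h : ∀ k : Fin r, (unit k.castSucc k.succ : U r) • v = 0)
    (h' : ∀ l : Fin (r + 1), (unit l l : U r) • v = mu (hdiag l) • v) : IsHighest mu v := by
  constructor
  · intro x
    rw [← traceFree_coe (x : SL r), Matrix.matrix_eq_sum_single (x : SL r).1, map_sum, map_sum,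
      Finset.sum_smul]
    refine Finset.sum_eq_zero fun i _ => ?_
    rw [map_sum, map_sum, Finset.sum_smul]
    refine Finset.sum_eq_zero fun j _ => ?_
    rcases lt_or_ge i j with hij | hij
    · rw [← mul_one ((x : SL r).1 i j), ← smul_eq_mul, ← Matrix.smul_single, map_smul, map_smul,
        smul_assoc]
      change _ • (unit i j : U r) • v = 0
      rw [unit_smul_eq_zero h hij, smul_zero]
    · rw [x.2 i j hij, Matrix.single_zero, map_zero, map_zero, zero_smul]
  · intro H
    have h1 : (H : SL r) = ∑ l, H.1.1 l l • traceFree r (Matrix.single l l 1) := by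
      conv_lhs => rw [cartan_eq_sum H]
      rw [AddSubmonoidClass.coe_finsetSum]
      rfl
    have h2 : mu H = ∑ l, H.1.1 l l • mu (hdiag l) := by
      conv_lhs => rw [cartan_eq_sum H]
      simp_rw [map_sum, map_smul]
    rw [h2]
    conv_lhs => rw [h1]
    rw [map_sum, Finset.sum_smul, Finset.sum_smul]
    refine Finset.sum_congr rfl fun l _ => ?_
    rw [map_smul, smul_assoc, smul_assoc]
    change _ • (unit l l : U r) • v = _
    rw [h' l]

end Singular

/-! ### The singular vector attached to one reflection -/

section SingleStep

variable {r : ℕ} {M : Type*} [AddCommGroup M] [Module ℂ M] [Module (U r) M]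
  [IsScalarTower ℂ (U r) M]

/-- The vectors `u • v`, where `u` is a combination of products of fewer than `d` negative root
vectors. -/
def filtSMul (d : ℕ) (v : M) : Submodule ℂ M :=
  (filt r d).map ((LinearMap.toSpanSingleton (U r) M v).restrictScalars ℂ)

theorem smul_mem_filtSMul {d : ℕ} {u : U r} (hu : u ∈ filt r d) (v : M) :
    u • v ∈ filtSMul (r := r) d v :=
  ⟨u, hu, rfl⟩

theorem filtSMul_mono {d d' : ℕ} (h : d ≤ d') (v : M) :
    filtSMul (r := r) d v ≤ filtSMul (r := r) d' v :=
  Submodule.map_mono (filt_mono h)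

theorem unit_smul_mem_filtSMul {d : ℕ} {v w : M} (hw : w ∈ filtSMul (r := r) d v)
    {i j : Fin (r + 1)} (hij : j < i) : (unit i j : U r) • w ∈ filtSMul (r := r) (d + 1) v := by
  obtain ⟨u, hu, rfl⟩ := hw
  refine ⟨unit i j * u, mul_mem_filt (unit_mem_filt hij) hu (by omega), ?_⟩
  exact mul_smul _ _ _

theorem lower_pow_apply_mem {d : ℕ} {v : M} {q : Fun r M}
    (h : ∀ b, q b ∈ filtSMul (r := r) d v) (i : Fin (r + 1)) (a : ℕ) (b : Fin (r + 1) → ℕ) :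
    (lower i ^ a) q b ∈ filtSMul (r := r) (d + a) v := by
  induction a generalizing b with
  | zero => exact h b
  | succ a ih =>
    rw [pow_succ', Module.End.mul_apply, lower, LinearMap.sum_apply, Finset.sum_apply]
    exact Submodule.sum_mem _ fun j hj =>
      unit_smul_mem_filtSMul (ih _) (Finset.mem_Ioi.1 hj)

theorem act_single_zero (i j : Fin (r + 1)) (y : M) :
    act i j (Pi.single 0 y : Fun r M) = Pi.single 0 ((unit i j : U r) • y) := by
  funext b
  rw [act_apply]
  rcases eq_or_ne b 0 with rfl | h
  · simp
  · simp [Pi.single_eq_of_ne h]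

theorem lower_single_zero (i : Fin (r + 1)) (y : M) : lower i (Pi.single 0 y : Fun r M) = 0 := by
  rw [lower, LinearMap.sum_apply]
  refine Finset.sum_eq_zero fun j _ => ?_
  rw [Module.End.mul_apply, shift_single_zero, map_zero]

theorem lower_raise_pow {i k : Fin (r + 1)} (h : i < k) (a : ℕ) :
    (lower i * raise k ^ (a + 1) : Module.End ℂ (Fun r M))
      = raise k ^ (a + 1) * lower i + ((a : ℂ) + 1) • (raise k ^ a * act k i) := by
  have hr : (lower i * raise k : Module.End ℂ (Fun r M)) = raise k * lower i + act k i := by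
    rw [raise_lower_of_lt h, sub_add_cancel]
  induction a with
  | zero => simp [raise_lower_of_lt h]
  | succ a ih =>
    rw [pow_succ (raise k) (a + 1), ← mul_assoc, ih, add_mul, mul_assoc (raise k ^ (a + 1)) (lower i),
      hr, smul_mul_assoc, mul_assoc _ (act k i),
      act_raise, ← mul_assoc _ (raise k) (act k i), ← pow_succ, mul_add, ← mul_assoc]
    push_cast
    module

/-- Only `x_k` is present, so every `D_i` acts as `E_{k,i} ∂_k`. The `a!` is what the normalisation
`1 / m!` of the chain cancels. -/
theorem lower_pow_raise_pow_single {i k : Fin (r + 1)} (h : i < k) (a : ℕ) (y : M) :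
    (lower i ^ a) ((raise k ^ a) (Pi.single 0 y : Fun r M))
      = (a.factorial : ℂ) • Pi.single 0 ((unit k i ^ a : U r) • y) := by
  induction a generalizing y with
  | zero => simp
  | succ a ih =>
    rw [pow_succ (lower i), Module.End.mul_apply, ← Module.End.mul_apply (lower i),
      lower_raise_pow h, LinearMap.add_apply, Module.End.mul_apply, lower_single_zero, map_zero,
      zero_add, LinearMap.smul_apply, map_smul, Module.End.mul_apply, act_single_zero, ih,
      pow_succ (unit k i), mul_smul, Nat.factorial_succ, smul_smul]
    push_cast
    rfl

/-- The exponents of the leading monomial `E_{p+1,p}^m ⋯ E_{q,q-1}^m`. -/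
def strip (p q : Fin (r + 1)) (m : ℕ) (k : Fin r) : ℕ :=
  if p ≤ k.castSucc ∧ k.succ ≤ q then m else 0

theorem strip_self (q : Fin (r + 1)) (m : ℕ) : strip q q m = 0 := by
  funext k
  rw [strip, if_neg]
  · rfl
  · rintro ⟨h, h'⟩
    exact (Fin.castSucc_lt_succ.trans_le (h'.trans h)).false

theorem strip_castSucc {i : Fin r} {q : Fin (r + 1)} (h : i.succ ≤ q) (m : ℕ) :
    strip i.castSucc q m = Pi.single i m + strip i.succ q m := by
  funext k
  simp only [strip, Pi.add_apply]
  rcases lt_trichotomy k i with hk | rfl | hk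
  · rw [Pi.single_eq_of_ne hk.ne, if_neg, if_neg]
    · rintro ⟨h1, -⟩
      have h1 := Fin.le_def.1 h1
      have hk := Fin.lt_def.1 hk
      simp only [Fin.val_succ, Fin.val_castSucc] at h1
      omega
    · rintro ⟨h1, -⟩
      exact hk.not_ge h1
  · rw [Pi.single_eq_same, if_pos ⟨le_rfl, h⟩, if_neg, add_zero]
    rintro ⟨h1, -⟩
    exact Fin.castSucc_lt_succ.not_ge h1
  · have h1 : i.castSucc ≤ k.castSucc := hk.le
    have h2 : i.succ ≤ k.castSucc := Fin.castSucc_lt_iff_succ_le.1 hk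
    simp [Pi.single_eq_of_ne hk.ne', h1, h2]

theorem lead_zero : (lead 0 : U r) = 1 := by
  rw [lead_eq_prod]
  have h : leadList (0 : Fin r → ℕ) = [] := List.flatMap_eq_nil_iff.2 fun _ _ => rfl
  rw [h, List.map_nil, List.prod_nil]

theorem lead_single (i : Fin r) (m : ℕ) :
    (lead (Pi.single i m) : U r) = unit i.succ i.castSucc ^ m := by
  rw [lead, List.ofFn_eq_map, List.prod_map_eq_pow_single i]
  · rw [List.count_eq_one_of_mem (List.nodup_finRange _) (List.mem_finRange _), pow_one, F_eq_unit,
      Pi.single_eq_same]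
  · intro k hk _
    rw [Pi.single_eq_of_ne hk, pow_zero]

/-- `(a!)⁻¹ ∏_{a ≤ s < m} (z + s)`. -/
def coef (z : ℂ) (m a : ℕ) : ℂ := (a.factorial : ℂ)⁻¹ * ∏ s ∈ Finset.Ico a m, (z + s)

theorem coef_self (z : ℂ) (m : ℕ) : coef z m m = (m.factorial : ℂ)⁻¹ := by
  simp [coef]

/-- Solves the recursion of `total_step` from the top value `1 / m!` downwards, so there is no
division by the factors `z + s`, which may vanish. -/
theorem coef_succ (z : ℂ) {m a : ℕ} (h : a < m) :
    coef z m a = coef z m (a + 1) * (a + 1) * (z + a) := by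
  have h1 : (a.factorial : ℂ) ≠ 0 := by exact_mod_cast a.factorial_ne_zero
  have h2 : (a : ℂ) + 1 ≠ 0 := by exact_mod_cast a.succ_ne_zero
  rw [coef, coef, Finset.prod_eq_prod_Ico_succ_bot h, Nat.factorial_succ]
  push_cast
  field_simp

/-- Only the variable `x_top` occurs, so all other derivatives vanish and the conditions reduce to
those on `v`. -/
theorem isChain_top {lam : Wt r} {v : M} (h : IsHighest lam v) (m : ℕ) (top : Fin (r + 1)) (z : ℂ) :
    IsChain (fun l => lam (hdiag l)) (lam (hdiag top)) m top top
      (z • (raise top ^ m) (Pi.single 0 v : Fun r M)) where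
  shift_eq l hl := by
    rw [map_smul, ← Module.End.mul_apply,
      (Commute.pow_right (shift_raise_of_ne hl.ne) m : Commute _ _).eq, Module.End.mul_apply,
      shift_single_zero, map_zero, smul_zero]
  total_eq k hk := by
    have hk' : top < k.succ := hk.trans_lt Fin.castSucc_lt_succ
    rw [total, map_smul, LinearMap.add_apply, Module.End.mul_apply,
      ← Module.End.mul_apply (shift _),
      (Commute.pow_right (shift_raise_of_ne hk'.ne') m : Commute _ _).eq, Module.End.mul_apply,
      shift_single_zero, map_zero, map_zero, zero_add, ← Module.End.mul_apply,
      (Commute.pow_right (act_raise _ _ _) m : Commute _ _).eq, Module.End.mul_apply,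
      act_single_zero, h.unit_smul Fin.castSucc_lt_succ, Pi.single_zero, map_zero, smul_zero]
  act_eq k _ := by
    rw [map_smul, ← Module.End.mul_apply,
      (Commute.pow_right (act_raise _ _ _) m : Commute _ _).eq, Module.End.mul_apply,
      act_single_zero, h.unit_smul Fin.castSucc_lt_succ, Pi.single_zero, map_zero, smul_zero]
  number_eq l := by
    have h0 : number l (Pi.single 0 v : Fun r M) = lam (hdiag l) • Pi.single 0 v := by
      rw [number, LinearMap.add_apply, Module.End.mul_apply, shift_single_zero, map_zero, add_zero,
        act_single_zero, h.unit_diag_smul, Pi.single_smul]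
    rw [map_smul, smul_comm]
    congr 1
    rcases eq_or_ne l top with rfl | hl
    · rw [if_pos rfl]
      induction m with
      | zero => simpa using h0
      | succ m ih =>
        rw [pow_succ', Module.End.mul_apply, ← Module.End.mul_apply (number l), number_raise_self,
          LinearMap.add_apply, Module.End.mul_apply, ih, map_smul]
        push_cast
        module
    · rw [if_neg hl, add_zero, ← Module.End.mul_apply,
        ((number_raise_of_ne hl).pow_right m).eq, Module.End.mul_apply, h0, map_smul]
  casimir := by
    have h1 : lower top ((raise top ^ m) (Pi.single 0 v : Fun r M)) = 0 := by
      rw [← Module.End.mul_apply,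
        (Commute.pow_right (raise_lower_of_le le_rfl).symm m : Commute _ _).eq,
        Module.End.mul_apply, lower_single_zero, map_zero]
    have h2 : act top top ((raise top ^ m) (Pi.single 0 v : Fun r M))
        = lam (hdiag top) • (raise top ^ m) (Pi.single 0 v : Fun r M) := by
      rw [← Module.End.mul_apply, (Commute.pow_right (act_raise _ _ _) m : Commute _ _).eq,
        Module.End.mul_apply, act_single_zero, h.unit_diag_smul, Pi.single_smul, map_smul]
    rw [map_smul, map_smul, lowerDiag_eq, act_shift, LinearMap.add_apply, h1, zero_add,
      Module.End.mul_apply, h2, map_smul, smul_comm]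
  mem_van := by
    refine Submodule.smul_mem _ _ ?_
    rw [add_comm m]
    refine raise_pow_mem_van (fun b hb => Pi.single_eq_of_ne (fun h0 => ?_) _) _
    simp [h0] at hb

/-- Iterates `isChain_step` while following the part with the most root vectors: it sits on `x_i^m`
and comes from the term `a = m` of each step. -/
theorem exists_chain {lam : Wt r} {v : M} (h : IsHighest lam v) (m : ℕ) (top : Fin (r + 1)) (d : ℕ)
    (i : Fin (r + 1)) (hi : i.val + d = top.val) :
    ∃ q R : Fun r M, IsChain (fun l => lam (hdiag l)) (lam (hdiag top) - d) m top i q ∧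
      q = (m.factorial : ℂ)⁻¹ • (raise i ^ m) (Pi.single 0 ((lead (strip i top m) : U r) • v)) + R ∧
      ∀ b, R b ∈ filtSMul (r := r) (∑ k, strip i top m k) v := by
  induction d generalizing i with
  | zero =>
    obtain rfl : i = top := Fin.ext (by simpa using hi)
    refine ⟨_, 0, by simpa using isChain_top h m i (m.factorial : ℂ)⁻¹, ?_, fun _ => zero_mem _⟩
    rw [strip_self, lead_zero, one_smul, add_zero]
  | succ d ih =>
    have hr : i.val < r := by
      have := top.2
      omega
    obtain ⟨k, rfl⟩ : ∃ k : Fin r, i = k.castSucc := ⟨⟨i, hr⟩, rfl⟩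
    have hk : k.succ.val + d = top.val := by
      rw [Fin.val_succ]
      rw [Fin.val_castSucc] at hi
      omega
    have ht : k.succ ≤ top := Fin.le_def.2 (by omega)
    obtain ⟨q, R, hq, hqR, hR⟩ := ih k.succ hk
    set N := ∑ j, strip k.succ top m j with hN
    set y := (lead (strip k.succ top m) : U r) • v with hy
    have hN' : ∑ j, strip k.castSucc top m j = m + N := by
      rw [strip_castSucc ht, hN]
      simp [Finset.sum_add_distrib]
    -- The argument of `coef` is `c - λ_k` for the current constant `c = λ_top - d`.
    have hsum := isChain_step hq ht (t := coef (lam (hdiag top) - d - lam (hdiag k.castSucc)) m)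
      (fun a ha => coef_succ _ ha)
    rw [sub_sub, ← Nat.cast_succ] at hsum
    refine ⟨_, _, hsum, (add_sub_cancel _ _).symm, fun b => ?_⟩
    have hq_mem : ∀ b, q b ∈ filtSMul (r := r) (N + 1) v := by
      intro b
      rw [hqR]
      refine add_mem (Submodule.smul_mem _ _ (raise_pow_apply_mem (fun b' => ?_) _ _ _))
        (filtSMul_mono (Nat.le_succ _) _ (hR b))
      rcases eq_or_ne b' 0 with rfl | hb'
      · rw [Pi.single_eq_same]
        exact smul_mem_filtSMul (lead_mem_filt _) v
      · rw [Pi.single_eq_of_ne hb']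
        exact zero_mem _
    have hfac : (m.factorial : ℂ) ≠ 0 := by exact_mod_cast m.factorial_ne_zero
    have hlow : (lower k.castSucc ^ m) q
        = Pi.single 0 ((unit k.succ k.castSucc ^ m : U r) • y) + (lower k.castSucc ^ m) R := by
      rw [hqR, map_add, map_smul, lower_pow_raise_pow_single Fin.castSucc_lt_succ,
        inv_smul_smul₀ hfac]
    have hlead : (unit k.succ k.castSucc ^ m : U r) • y - (lead (strip k.castSucc top m) : U r) • v
        ∈ filtSMul (r := r) (m + N) v := by
      rw [hy, smul_smul, ← sub_smul, ← lead_single, ← hN', strip_castSucc ht]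
      exact smul_mem_filtSMul (lead_mul_lead _ _) v
    -- The terms `a < m` have at most `N + a` factors and belong to the remainder; from `a = m` the
    -- leading monomial is removed.
    have hsplit : step (coef (lam (hdiag top) - d - lam (hdiag k.castSucc)) m) m k.castSucc q
          - (m.factorial : ℂ)⁻¹ • (raise k.castSucc ^ m)
            (Pi.single 0 ((lead (strip k.castSucc top m) : U r) • v))
        = ∑ a ∈ Finset.range m, coef (lam (hdiag top) - d - lam (hdiag k.castSucc)) m a •
            (raise k.castSucc ^ a) ((lower k.castSucc ^ a) q)
          + (m.factorial : ℂ)⁻¹ • (raise k.castSucc ^ m)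
            (Pi.single 0 ((unit k.succ k.castSucc ^ m : U r) • y
              - (lead (strip k.castSucc top m) : U r) • v) + (lower k.castSucc ^ m) R) := by
      rw [step, Finset.sum_range_succ, coef_self, hlow, add_sub_assoc, ← smul_sub, ← map_sub,
        Pi.single_sub]
      congr 3
      abel
    rw [hsplit, hN', Pi.add_apply, Finset.sum_apply]
    refine add_mem (Submodule.sum_mem _ fun a ha => Submodule.smul_mem _ _ ?_)
      (Submodule.smul_mem _ _ (raise_pow_apply_mem (fun b' => ?_) _ _ _))
    · refine filtSMul_mono ?_ v (raise_pow_apply_mem (lower_pow_apply_mem hq_mem _ _) _ _ _)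
      have := Finset.mem_range.1 ha
      omega
    · refine add_mem ?_ ?_
      · rcases eq_or_ne b' 0 with rfl | hb'
        · rw [Pi.single_eq_same]
          exact hlead
        · rw [Pi.single_eq_of_ne hb']
          exact zero_mem _
      · rw [add_comm m]
        exact lower_pow_apply_mem hR _ _ _

theorem number_lower_pow (i l : Fin (r + 1)) {z : ℂ} {q : Fun r M} (h : number l q = z • q)
    (a : ℕ) : number l ((lower i ^ a) q) = (z - if l = i then (a : ℂ) else 0) • (lower i ^ a) q := by
  rcases eq_or_ne l i with rfl | hl
  · rw [if_pos rfl]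
    induction a with
    | zero => simpa using h
    | succ a ih =>
      rw [pow_succ', Module.End.mul_apply, ← Module.End.mul_apply (number l), number_lower_self,
        LinearMap.sub_apply, Module.End.mul_apply, ih, map_smul]
      push_cast
      module
  · rw [if_neg hl, sub_zero, ← Module.End.mul_apply, ((number_lower_of_ne hl).pow_right a).eq,
      Module.End.mul_apply, h, map_smul]

/-- The vector is the constant term of `D_p^m q`, with `q` the chain at `p + 1`. Simple root vectors
below `p` commute with `D_p` and kill `q`, those above do so through the total action, and
`E_{p,p+1}` produces a scalar that vanishes. -/
theorem exists_singular_of_reflection {lam : Wt r} {v : M} (h : IsHighest lam v) (β : PosRoot r)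
    {m : ℕ} (hm : 0 < m) (hβ : (lam + rho r) (coroot β) = m) :
    ∃ u : U r, u - lead (strip β.1.1 β.1.2 m) ∈ filt r (∑ k, strip (r := r) β.1.1 β.1.2 m k) ∧
      IsHighest (lam - (m : ℂ) • root β) (u • v) := by
  obtain ⟨⟨p, top⟩, hlt⟩ := β
  change p < top at hlt
  have hpr : p.val < r := by
    have := Fin.lt_def.1 hlt
    have := top.2
    omega
  obtain ⟨i, rfl⟩ : ∃ i : Fin r, p = i.castSucc := ⟨⟨p, hpr⟩, rfl⟩
  have ht : i.succ ≤ top := Fin.castSucc_lt_iff_succ_le.1 hlt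
  have htv := Fin.le_def.1 ht
  obtain ⟨q, R, hq, hqR, hR⟩ := exists_chain h m top (top.val - i.succ.val) i.succ (by omega)
  obtain ⟨n, rfl⟩ : ∃ n, m = n + 1 := ⟨m - 1, by omega⟩
  have hfac : ((n + 1).factorial : ℂ) ≠ 0 := by exact_mod_cast (n + 1).factorial_ne_zero
  set w := (lower i.castSucc ^ (n + 1)) q 0 with hw
  have hlow : w = (unit i.succ i.castSucc ^ (n + 1) : U r) • (lead (strip i.succ top (n + 1)) : U r) • v
      + (lower i.castSucc ^ (n + 1)) R 0 := by
    rw [hw, hqR, map_add, map_smul, lower_pow_raise_pow_single Fin.castSucc_lt_succ,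
      inv_smul_smul₀ hfac, Pi.add_apply, Pi.single_eq_same]
  obtain ⟨u, hu, hu'⟩ := lower_pow_apply_mem hR i.castSucc (n + 1) 0
  change u • v = _ at hu'
  have hN : ∑ j, strip i.castSucc top (n + 1) j = ∑ j, strip i.succ top (n + 1) j + (n + 1) := by
    rw [strip_castSucc ht]
    simp [Finset.sum_add_distrib, add_comm]
  refine ⟨lead (Pi.single i (n + 1)) * lead (strip i.succ top (n + 1)) + u, ?_, ?_⟩
  · change _ - lead (strip i.castSucc top (n + 1)) ∈ filt r (∑ j, strip i.castSucc top (n + 1) j)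
    rw [add_sub_right_comm]
    refine add_mem ?_ (hN ▸ hu)
    rw [strip_castSucc ht]
    exact lead_mul_lead _ _
  rw [add_smul, mul_smul, lead_single, hu', ← hlow]
  -- The only use of the value of `⟨λ + ρ, β^∨⟩`: `ρ` contributes the difference of the two indices,
  -- and `n = m - 1`.
  have hz : lam (hdiag i.castSucc) - n - (lam (hdiag top) - ((top.val - i.succ.val : ℕ) : ℂ)) = 0 := by
    rw [LinearMap.add_apply, rho_coroot, coroot_eq, map_sub] at hβ
    rw [Nat.cast_sub htv, Fin.val_succ]
    simp only [Fin.val_castSucc] at hβ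
    push_cast at hβ ⊢
    linear_combination hβ
  refine isHighest_of_unit (fun k => ?_) fun l => ?_
  · change act k.castSucc k.succ ((lower i.castSucc ^ (n + 1)) q) 0 = 0
    rcases lt_trichotomy k i with hk | rfl | hk
    · have hk1 : k.castSucc < i.castSucc := hk
      rw [← Module.End.mul_apply, (Commute.pow_right (act_lower_of_lt hk1
        (Fin.castSucc_lt_iff_succ_le.1 hk1)) _ : Commute _ _).eq, Module.End.mul_apply,
        hq.act_eq k (hk1.trans Fin.castSucc_lt_succ), map_zero, Pi.zero_apply]
    · rw [act_succ_lower_pow (hq.act_eq k Fin.castSucc_lt_succ)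
        (hq.act_diag Fin.castSucc_lt_succ ht) hq.casimir, hz, mul_zero, zero_smul, Pi.zero_apply]
    · have hk1 : i.castSucc < k.castSucc := hk
      have h0 : total k ((lower i.castSucc ^ (n + 1)) q) = 0 := by
        rw [← Module.End.mul_apply, (Commute.pow_right (total_lower hk1) _ : Commute _ _).eq,
          Module.End.mul_apply, hq.total_eq k (Fin.castSucc_lt_iff_succ_le.1 hk1), map_zero]
      -- At the multi-index `0` the summand `x_k ∂_{k+1}` drops out, and the total action is the
      -- action on `M`.
      have h1 := congrFun h0 0
      rwa [total, LinearMap.add_apply, Pi.add_apply, Module.End.mul_apply, raise_apply_zero,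
        zero_add] at h1
  · have h1 := congrFun (number_lower_pow i.castSucc l (hq.number_eq l) (n + 1)) 0
    rw [number, LinearMap.add_apply, Pi.add_apply, Module.End.mul_apply, raise_apply_zero,
      add_zero] at h1
    refine h1.trans ?_
    rw [Pi.smul_apply, LinearMap.sub_apply, LinearMap.smul_apply, root_hdiag]
    congr 1
    simp only [smul_eq_mul, mul_sub, mul_ite, mul_one, mul_zero]
    ring

end SingleStep

/-! ### The dual of the ring of functions on the big cell -/

section BigCell

open MvPolynomial

variable {r : ℕ}

variable (r) in
/-- The ring of functions on the group of lower triangular unipotent matrices. -/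
abbrev Cell := MvPolynomial (NegIdx r) ℂ

/-- Square matrices over the ring of functions. -/
abbrev CellMat (r : ℕ) := Matrix (Fin (r + 1)) (Fin (r + 1)) (Cell r)

variable (r) in
/-- The generic lower triangular unipotent matrix. -/
def gen : CellMat r := Matrix.of fun i j =>
  if h : j < i then X ⟨(i, j), h⟩ else if i = j then 1 else 0

theorem gen_of_lt {i j : Fin (r + 1)} (h : j < i) : gen r i j = X ⟨(i, j), h⟩ := dif_pos h

theorem gen_self (i : Fin (r + 1)) : gen r i i = 1 := by
  simp [gen]

theorem gen_of_gt {i j : Fin (r + 1)} (h : i < j) : gen r i j = 0 := by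
  simp [gen, h.not_gt, h.ne]

theorem det_gen : (gen r).det = 1 := by
  rw [Matrix.det_of_isLowerTriangular _ fun i j h => gen_of_gt h]
  exact Finset.prod_eq_one fun i _ => gen_self i

theorem inv_mul_gen : (gen r)⁻¹ * gen r = 1 :=
  Matrix.nonsing_inv_mul _ (by rw [det_gen]; exact isUnit_one)

theorem gen_mul_inv : gen r * (gen r)⁻¹ = 1 :=
  Matrix.mul_nonsing_inv _ (by rw [det_gen]; exact isUnit_one)

/-- The matrix `g⁻¹ A g`, where `g` is the generic unipotent matrix. -/
def conj (A : Matrix (Fin (r + 1)) (Fin (r + 1)) ℂ) : CellMat r :=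
  (gen r)⁻¹ * A.map C * gen r

theorem conj_add (A B : Matrix (Fin (r + 1)) (Fin (r + 1)) ℂ) :
    conj (A + B) = conj A + conj B := by
  rw [conj, Matrix.map_add _ (map_add C), mul_add, add_mul]
  rfl

theorem conj_smul (c : ℂ) (A : Matrix (Fin (r + 1)) (Fin (r + 1)) ℂ) :
    conj (c • A) = c • conj A := by
  have h : (c • A).map (C : ℂ →+* Cell r) = c • A.map C := by
    ext1 i j
    simp [C_mul']
  rw [conj, h, mul_smul_comm, smul_mul_assoc]
  rfl

theorem conj_mul (A B : Matrix (Fin (r + 1)) (Fin (r + 1)) ℂ) :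
    conj (A * B) = conj A * conj B := by
  rw [conj, conj, conj, Matrix.map_mul]
  simp only [mul_assoc]
  rw [← mul_assoc (gen r) (gen r)⁻¹, gen_mul_inv, one_mul]

theorem conj_sub (A B : Matrix (Fin (r + 1)) (Fin (r + 1)) ℂ) :
    conj (A - B) = conj A - conj B := by
  rw [eq_sub_iff_add_eq, ← conj_add, sub_add_cancel]

/-! ### Twisted vector fields on the lower unipotent group -/

/-- The strictly lower triangular part of a matrix. -/
def low {R : Type*} [Zero R] (A : Matrix (Fin (r + 1)) (Fin (r + 1)) R) :
    Matrix (Fin (r + 1)) (Fin (r + 1)) R :=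
  Matrix.of fun i j => if j < i then A i j else 0

theorem low_apply {R : Type*} [Zero R] (A : Matrix (Fin (r + 1)) (Fin (r + 1)) R)
    (i j : Fin (r + 1)) : low A i j = if j < i then A i j else 0 := rfl

/-- The two sides differ by the low part of the commutator of the upper triangular parts, which is
zero. The last term is already strictly lower triangular. -/
theorem low_commutator {R : Type*} [CommRing R] (A B : Matrix (Fin (r + 1)) (Fin (r + 1)) R) :
    low (A * B - B * A) = low (low A * B - B * low A) - low (low B * A - A * low B)
      - (low A * low B - low B * low A) := by
  ext i j
  simp only [low_apply, Matrix.sub_apply, Matrix.mul_apply, ← Finset.sum_sub_distrib]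
  split_ifs with h
  · rw [← Finset.sum_sub_distrib, ← Finset.sum_sub_distrib]
    refine Finset.sum_congr rfl fun k _ => ?_
    by_cases h1 : k < i
    · by_cases h2 : j < k
      · simp only [h1, h2, if_true]
        ring
      · simp only [h1, h2, if_true, if_false]
        ring
    · have h2 : j < k := h.trans_le (not_lt.1 h1)
      simp only [h1, h2, if_true, if_false]
      ring
  · rw [sub_zero, zero_sub, eq_comm, neg_eq_zero]
    refine Finset.sum_eq_zero fun k _ => ?_
    by_cases h1 : k < i
    · have h2 : ¬ j < k := fun h2 => h (h2.trans h1)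
      simp [h2]
    · simp [h1]

theorem commutator_diag {R : Type*} [CommRing R] (A B : Matrix (Fin (r + 1)) (Fin (r + 1)) R)
    (l : Fin (r + 1)) : (A * B - B * A) l l
      = (low A * B - B * low A) l l - (low B * A - A * low B) l l := by
  simp only [low_apply, Matrix.sub_apply, Matrix.mul_apply, ← Finset.sum_sub_distrib]
  refine Finset.sum_congr rfl fun k _ => ?_
  rcases lt_trichotomy k l with h | rfl | h
  · simp only [h, h.not_gt, if_true, if_false]
    ring
  · simp only [lt_irrefl, if_false]
    ring
  · simp only [h, h.not_gt, if_true, if_false]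
    ring

/-- The vector field on the big cell given by a matrix. -/
def field (A : Matrix (Fin (r + 1)) (Fin (r + 1)) ℂ) : Derivation ℂ (Cell r) (Cell r) :=
  mkDerivation ℂ fun p => -(gen r * low (conj A)) p.1.1 p.1.2

theorem field_X (A : Matrix (Fin (r + 1)) (Fin (r + 1)) ℂ) (p : NegIdx r) :
    field A (X p) = -(gen r * low (conj A)) p.1.1 p.1.2 :=
  mkDerivation_X _ _ _

theorem map_mul_derivation {R S : Type*} [CommRing R] [CommRing S] [Algebra R S]
    (D : Derivation R S S) (A B : Matrix (Fin (r + 1)) (Fin (r + 1)) S) :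
    (A * B).map D = A.map D * B + A * B.map D := by
  ext i j
  simp only [Matrix.map_apply, Matrix.add_apply, Matrix.mul_apply, map_sum, Derivation.leibniz,
    smul_eq_mul, ← Finset.sum_add_distrib]
  exact Finset.sum_congr rfl fun k _ => by ring

theorem gen_mul_low_of_le (A : CellMat r) {i j : Fin (r + 1)} (h : i ≤ j) :
    (gen r * low A) i j = 0 := by
  rw [Matrix.mul_apply]
  refine Finset.sum_eq_zero fun k _ => ?_
  rw [low_apply]
  split_ifs with hk
  · rw [gen_of_gt (h.trans_lt hk), zero_mul]
  · rw [mul_zero]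

/-- Since `A g = g (g⁻¹ A g)`, modulo `𝔟` on the right only the strictly lower part of `g⁻¹ A g`
moves `g`; its diagonal part later enters through `mult`. The constant entries of `g` are consistent
because `g * low _` is strictly lower triangular. -/
theorem gen_map_field (A : Matrix (Fin (r + 1)) (Fin (r + 1)) ℂ) :
    (gen r).map (field A) = -(gen r * low (conj A)) := by
  ext1 i j
  rw [Matrix.map_apply, Matrix.neg_apply]
  rcases lt_trichotomy j i with h | rfl | h
  · rw [gen_of_lt h, field_X]
  · rw [gen_self, Derivation.map_one_eq_zero, gen_mul_low_of_le _ le_rfl, neg_zero]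
  · rw [gen_of_gt h, map_zero, gen_mul_low_of_le _ h.le, neg_zero]

theorem inv_gen_map_field (A : Matrix (Fin (r + 1)) (Fin (r + 1)) ℂ) :
    (gen r)⁻¹.map (field A) = low (conj A) * (gen r)⁻¹ := by
  have h := map_mul_derivation (field A) (gen r)⁻¹ (gen r)
  have h1 : (1 : CellMat r).map (field A) = 0 := by
    ext1 i j
    rw [Matrix.map_apply, Matrix.one_apply]
    split_ifs <;> simp
  rw [inv_mul_gen, h1, gen_map_field, mul_neg, ← mul_assoc, inv_mul_gen, one_mul, eq_comm,
    ← sub_eq_add_neg, sub_eq_zero] at h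
  rw [← h, mul_assoc, gen_mul_inv, mul_one]

theorem conj_map_field (A B : Matrix (Fin (r + 1)) (Fin (r + 1)) ℂ) :
    (conj B).map (field A) = low (conj A) * conj B - conj B * low (conj A) := by
  have h1 : (B.map C : CellMat r).map (field A) = 0 := by
    ext1 i j
    rw [Matrix.map_apply, Matrix.map_apply, ← algebraMap_eq, Derivation.map_algebraMap]
    rfl
  conv_lhs => rw [conj]
  rw [map_mul_derivation, map_mul_derivation, h1, inv_gen_map_field, gen_map_field]
  simp only [conj, mul_zero, add_zero, mul_neg, mul_assoc, sub_eq_add_neg]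

theorem low_conj_map_field (A B : Matrix (Fin (r + 1)) (Fin (r + 1)) ℂ) :
    (low (conj B)).map (field A) = low (low (conj A) * conj B - conj B * low (conj A)) := by
  rw [← conj_map_field]
  ext1 i j
  simp only [Matrix.map_apply, low_apply]
  split_ifs <;> simp

theorem field_field_X (A B : Matrix (Fin (r + 1)) (Fin (r + 1)) ℂ) (p : NegIdx r) :
    field A (field B (X p)) = (gen r * (low (conj A) * low (conj B)
      - low (low (conj A) * conj B - conj B * low (conj A)))) p.1.1 p.1.2 := by
  have h : (gen r * low (conj B)).map (field A) = -(gen r * (low (conj A) * low (conj B)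
      - low (low (conj A) * conj B - conj B * low (conj A)))) := by
    rw [map_mul_derivation, low_conj_map_field, gen_map_field, mul_sub, neg_mul, mul_assoc]
    abel
  have h1 := Matrix.ext_iff.2 h p.1.1 p.1.2
  rw [Matrix.map_apply, Matrix.neg_apply] at h1
  rw [field_X, map_neg, h1, neg_neg]

/-- On coordinates, the bracket of the two fields is the right side of `low_commutator` for the
conjugated matrices. -/
theorem field_lie (A B : Matrix (Fin (r + 1)) (Fin (r + 1)) ℂ) :
    field (A * B - B * A) = ⁅field A, field B⁆ := by
  refine derivation_ext fun p => ?_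
  rw [field_X, Derivation.commutator_apply, field_field_X, field_field_X, conj_sub, conj_mul,
    conj_mul, low_commutator, ← Matrix.sub_apply, ← Matrix.neg_apply, ← mul_sub, ← mul_neg]
  refine congrFun (congrFun (congrArg (gen r * ·) ?_) p.1.1) p.1.2
  abel

/-- The multiplier attached to a weight. -/
def mult (lam : Wt r) (A : Matrix (Fin (r + 1)) (Fin (r + 1)) ℂ) : Cell r :=
  ∑ l, lam (hdiag l) • conj A l l

/-- The cocycle identity that allows the vector fields to be twisted by `λ` while remaining a
representation. -/
theorem field_mult (lam : Wt r) (A B : Matrix (Fin (r + 1)) (Fin (r + 1)) ℂ) :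
    mult lam (A * B - B * A) = field A (mult lam B) - field B (mult lam A) := by
  have h : ∀ A B : Matrix (Fin (r + 1)) (Fin (r + 1)) ℂ, ∀ l, field A (conj B l l)
      = (low (conj A) * conj B - conj B * low (conj A)) l l := by
    intro A B l
    rw [← conj_map_field]
    rfl
  simp only [mult, map_sum, Derivation.map_smul, h]
  rw [← Finset.sum_sub_distrib]
  refine Finset.sum_congr rfl fun l _ => ?_
  rw [conj_sub, conj_mul, conj_mul, commutator_diag, smul_sub]

/-- The action of `𝔤` on the functions on the big cell, twisted by a weight. -/
def cellRep (lam : Wt r) : SL r →ₗ⁅ℂ⁆ Module.End ℂ (Cell r) where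
  toFun A := (field A.1 : Cell r →ₗ[ℂ] Cell r) - LinearMap.mulLeft ℂ (mult lam A.1)
  map_add' A B := by
    have h1 : field (A.1 + B.1) = field A.1 + field B.1 := by
      refine derivation_ext fun p => ?_
      have h : low (conj A.1 + conj B.1) = low (conj A.1) + low (conj B.1) := by
        ext1 i j
        simp only [low_apply, Matrix.add_apply]
        split_ifs <;> simp
      rw [Derivation.add_apply, field_X, field_X, field_X, conj_add, h, mul_add, Matrix.add_apply,
        neg_add]
    have h2 : mult lam (A.1 + B.1) = mult lam A.1 + mult lam B.1 := by
      simp only [mult, conj_add, Matrix.add_apply, smul_add, Finset.sum_add_distrib]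
    refine LinearMap.ext fun f => ?_
    change field (A.1 + B.1) f - mult lam (A.1 + B.1) * f
      = field A.1 f - mult lam A.1 * f + (field B.1 f - mult lam B.1 * f)
    rw [h1, h2, Derivation.add_apply]
    ring
  map_smul' c A := by
    have h1 : field (c • A.1) = c • field A.1 := by
      refine derivation_ext fun p => ?_
      have h : low (c • conj A.1) = c • low (conj A.1) := by
        ext1 i j
        simp only [low_apply, Matrix.smul_apply]
        split_ifs <;> simp
      rw [Derivation.smul_apply, field_X, field_X, conj_smul, h, mul_smul_comm, Matrix.smul_apply,
        smul_neg]
    have h2 : mult lam (c • A.1) = c • mult lam A.1 := by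
      simp only [mult, conj_smul, Matrix.smul_apply, Finset.smul_sum]
      exact Finset.sum_congr rfl fun l _ => smul_comm _ _ _
    refine LinearMap.ext fun f => ?_
    change field (c • A.1) f - mult lam (c • A.1) * f = c • (field A.1 f - mult lam A.1 * f)
    rw [h1, h2, Derivation.smul_apply, smul_sub, smul_mul_assoc]
  map_lie' := by
    intro A B
    refine LinearMap.ext fun f => ?_
    change field (A.1 * B.1 - B.1 * A.1) f - mult lam (A.1 * B.1 - B.1 * A.1) * f
      = (field A.1 (field B.1 f - mult lam B.1 * f) - mult lam A.1 * (field B.1 f - mult lam B.1 * f))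
        - (field B.1 (field A.1 f - mult lam A.1 * f)
          - mult lam B.1 * (field A.1 f - mult lam A.1 * f))
    rw [field_lie, field_mult, Derivation.commutator_apply]
    simp only [map_sub, Derivation.leibniz, smul_eq_mul]
    ring

theorem cellRep_apply (lam : Wt r) (A : SL r) (f : Cell r) :
    cellRep lam A f = field A.1 f - mult lam A.1 * f := rfl

/-- The dual of the representation `cellRep`. -/
def dualRep (lam : Wt r) : SL r →ₗ⁅ℂ⁆ Module.End ℂ (Module.Dual ℂ (Cell r)) where
  toFun A := -(cellRep lam A).dualMap
  map_add' A B := by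
    refine LinearMap.ext fun φ => LinearMap.ext fun f => ?_
    change -φ (cellRep lam (A + B) f) = -φ (cellRep lam A f) + -φ (cellRep lam B f)
    rw [map_add, LinearMap.add_apply, map_add, neg_add]
  map_smul' c A := by
    refine LinearMap.ext fun φ => LinearMap.ext fun f => ?_
    change -φ (cellRep lam (c • A) f) = c • -φ (cellRep lam A f)
    rw [map_smul, LinearMap.smul_apply, map_smul, smul_neg]
  map_lie' := by
    intro A B
    refine LinearMap.ext fun φ => LinearMap.ext fun f => ?_
    change -φ (cellRep lam ⁅A, B⁆ f)
      = - -φ (cellRep lam B (cellRep lam A f)) - - -φ (cellRep lam A (cellRep lam B f))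
    rw [LieHom.map_lie, LieRing.of_associative_ring_bracket, LinearMap.sub_apply, map_sub,
      Module.End.mul_apply, Module.End.mul_apply]
    ring

/-! ### Evaluation at the identity and orders of vanishing -/

variable (r) in
/-- Evaluation at the identity matrix. -/
def origin : Cell r →ₐ[ℂ] ℂ := aeval 0

variable (r) in
/-- The ideal of the identity matrix. -/
def originIdeal : Ideal (Cell r) := RingHom.ker (origin r)

theorem gen_map_origin : (gen r).map (origin r) = 1 := by
  ext i j
  rw [Matrix.map_apply]
  rcases lt_trichotomy j i with h | rfl | h
  · rw [gen_of_lt h, origin, aeval_X, Matrix.one_apply_ne h.ne', Pi.zero_apply]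
  · rw [gen_self, map_one, Matrix.one_apply_eq]
  · rw [gen_of_gt h, map_zero, Matrix.one_apply_ne h.ne]

theorem conj_map_origin (A : Matrix (Fin (r + 1)) (Fin (r + 1)) ℂ) :
    (conj A).map (origin r) = A := by
  have h1 : (gen r)⁻¹.map (origin r) = 1 := by
    have h := congrArg (fun N : CellMat r => N.map (origin r)) (inv_mul_gen (r := r))
    simp only [Matrix.map_mul, gen_map_origin, mul_one] at h
    rw [h, Matrix.map_one _ (map_zero _) (map_one _)]
  have h2 : (A.map C : CellMat r).map (origin r) = A := by
    ext i j
    simp [origin]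
  rw [conj, Matrix.map_mul, Matrix.map_mul, gen_map_origin, h1, h2, mul_one, one_mul]

theorem origin_field_X (A : Matrix (Fin (r + 1)) (Fin (r + 1)) ℂ) (p : NegIdx r) :
    origin r (field A (X p)) = -A p.1.1 p.1.2 := by
  have h2 : (low (conj A)).map (origin r) = low A := by
    ext1 i j
    rw [Matrix.map_apply, low_apply, low_apply, apply_ite (origin r), map_zero]
    congr 1
    exact congrFun (congrFun (conj_map_origin A) i) j
  have h : (gen r * low (conj A)).map (origin r) = low A := by
    rw [Matrix.map_mul, gen_map_origin, h2, one_mul]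
  have h3 := Matrix.ext_iff.2 h p.1.1 p.1.2
  rw [Matrix.map_apply, low_apply, if_pos p.2] at h3
  rw [field_X, map_neg, h3]

theorem origin_mult (lam : Wt r) (A : Matrix (Fin (r + 1)) (Fin (r + 1)) ℂ) :
    origin r (mult lam A) = ∑ l, lam (hdiag l) * A l l := by
  rw [mult, map_sum]
  refine Finset.sum_congr rfl fun l _ => ?_
  rw [map_smul, smul_eq_mul]
  congr 1
  exact congrFun (congrFun (conj_map_origin A) l) l

theorem derivation_mem {D : Derivation ℂ (Cell r) (Cell r)} {J : Ideal (Cell r)}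
    (h : ∀ p, D (X p) ∈ J) (f : Cell r) : D f ∈ J := by
  induction f using MvPolynomial.induction_on with
  | C a =>
    rw [← algebraMap_eq, Derivation.map_algebraMap]
    exact zero_mem _
  | add f g hf hg => rw [map_add]; exact add_mem hf hg
  | mul_X f p hf =>
    rw [Derivation.leibniz]
    exact add_mem (J.mul_mem_left _ (h p)) (J.mul_mem_left _ hf)

theorem derivation_pow_succ_mem {R S : Type*} [CommRing R] [CommRing S] [Algebra R S]
    (D : Derivation R S S) (J : Ideal S) {k : ℕ} {f : S} (hf : f ∈ J ^ (k + 1)) :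
    D f ∈ J ^ k := by
  induction k generalizing f with
  | zero => simp
  | succ k ih =>
    rw [pow_succ'] at hf
    induction hf using Submodule.mul_induction_on' with
    | mem_mul_mem a ha b hb =>
      rw [Derivation.leibniz]
      refine add_mem ?_ (Ideal.mul_mem_right _ _ hb)
      rw [pow_succ']
      exact Ideal.mul_mem_mul ha (ih hb)
    | add a _ b _ ha hb => rw [map_add]; exact add_mem ha hb

theorem derivation_pow_mem {R S : Type*} [CommRing R] [CommRing S] [Algebra R S]
    {D : Derivation R S S} {J : Ideal S} (hD : ∀ f, D f ∈ J) {k : ℕ} {f : S} (hf : f ∈ J ^ k) :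
    D f ∈ J ^ k := by
  induction k generalizing f with
  | zero => simp
  | succ k ih =>
    rw [pow_succ'] at hf ⊢
    induction hf using Submodule.mul_induction_on' with
    | mem_mul_mem a ha b hb =>
      rw [Derivation.leibniz]
      refine add_mem (Ideal.mul_mem_mul ha (ih hb)) ?_
      rw [smul_eq_mul, mul_comm b]
      exact Ideal.mul_mem_mul (hD a) hb
    | add a _ b _ ha hb => rw [map_add]; exact add_mem ha hb

theorem X_mem_originIdeal (p : NegIdx r) : (X p : Cell r) ∈ originIdeal r := by
  rw [originIdeal, RingHom.mem_ker]
  simp [origin]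

/-- At the identity the vector field of `E_p` equals `-∂_p` and its multiplier vanishes, so the
discrepancy does not lower the order of vanishing. -/
theorem cellRep_add_pderiv_mem (lam : Wt r) (p : NegIdx r) {k : ℕ} {f : Cell r}
    (hf : f ∈ originIdeal r ^ k) :
    cellRep lam (LieAlgebra.SpecialLinear.single p.1.1 p.1.2 p.2.ne' (1 : ℂ)) f + pderiv p f
      ∈ originIdeal r ^ k := by
  have h1 : ∀ g, (field (Matrix.single p.1.1 p.1.2 1) + pderiv p :
      Derivation ℂ (Cell r) (Cell r)) g ∈ originIdeal r := by
    refine derivation_mem fun q => ?_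
    rw [originIdeal, RingHom.mem_ker, Derivation.add_apply]
    change origin r (_ + _) = 0
    rw [map_add, origin_field_X, pderiv_X, Matrix.single_apply]
    rcases eq_or_ne q p with rfl | hqp
    · simp
    · have h : ¬ (p.1.1 = q.1.1 ∧ p.1.2 = q.1.2) :=
        fun h => hqp (Subtype.ext (Prod.ext h.1 h.2)).symm
      rw [if_neg h, Pi.single_eq_of_ne hqp]
      simp
  have h2 : mult lam (Matrix.single p.1.1 p.1.2 1) ∈ originIdeal r := by
    rw [originIdeal, RingHom.mem_ker]
    change origin r _ = 0
    rw [origin_mult]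
    refine Finset.sum_eq_zero fun l _ => ?_
    rw [Matrix.single_apply_of_ne _ _ _ _ _ fun h => p.2.ne (h.2.trans h.1.symm), mul_zero]
  rw [cellRep_apply, sub_add_eq_add_sub]
  refine sub_mem (derivation_pow_mem h1 hf) (Ideal.mul_mem_left _ _ hf)

/-! ### Pairing `U(𝔤)` with functions -/

/-- The functional `u · origin`. -/
def functional (lam : Wt r) (u : U r) : Module.Dual ℂ (Cell r) :=
  UniversalEnvelopingAlgebra.lift ℂ (dualRep lam) u (origin r).toLinearMap

theorem functional_F_mul (lam : Wt r) (p : NegIdx r) (u : U r) (f : Cell r) :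
    functional lam (F p * u) f = -functional lam u
      (cellRep lam (LieAlgebra.SpecialLinear.single p.1.1 p.1.2 p.2.ne' (1 : ℂ)) f) := by
  rw [functional, map_mul, F, UniversalEnvelopingAlgebra.lift_ι_apply]
  rfl

/-- Each factor lowers the order of vanishing by at most one, so fewer than `k` of them leave it
positive. -/
theorem functional_prod_eq_zero (lam : Wt r) {l : List (NegIdx r)} {k : ℕ} (hk : l.length < k)
    {f : Cell r} (hf : f ∈ originIdeal r ^ k) : functional lam (l.map F).prod f = 0 := by
  induction l generalizing k f with
  | nil =>
    have h : f ∈ originIdeal r := Ideal.pow_le_self (Nat.pos_iff_ne_zero.1 hk) hf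
    rw [List.map_nil, List.prod_nil, functional, map_one]
    exact h
  | cons p l ih =>
    obtain ⟨k, rfl⟩ : ∃ n, k = n + 1 := ⟨k - 1, by omega⟩
    rw [List.map_cons, List.prod_cons, functional_F_mul, neg_eq_zero]
    refine ih (Nat.lt_of_succ_lt_succ hk) ?_
    rw [← add_sub_cancel_right (cellRep lam _ f) (pderiv p f)]
    exact sub_mem (Ideal.pow_le_pow_right (Nat.le_succ k) (cellRep_add_pderiv_mem lam p hf))
      (derivation_pow_succ_mem _ _ hf)

theorem functional_eq_zero (lam : Wt r) {k : ℕ} {u : U r} (hu : u ∈ filt r k)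
    {f : Cell r} (hf : f ∈ originIdeal r ^ k) : functional lam u f = 0 := by
  induction hu using Submodule.span_induction with
  | zero => rw [functional, map_zero]; rfl
  | add x y _ _ hx hy =>
    rw [functional] at hx hy ⊢
    rw [map_add, LinearMap.add_apply, LinearMap.add_apply, hx, hy, add_zero]
  | smul c x _ hx =>
    rw [functional] at hx ⊢
    rw [map_smul, LinearMap.smul_apply, LinearMap.smul_apply, hx, smul_zero]
  | mem x hx =>
    obtain ⟨l, hl, rfl⟩ := hx
    exact functional_prod_eq_zero lam hl hf

theorem functional_cons (lam : Wt r) (p : NegIdx r) (l : List (NegIdx r)) {f : Cell r}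
    (hf : f ∈ originIdeal r ^ (l.length + 1)) :
    functional lam ((p :: l).map F).prod f = functional lam (l.map F).prod (pderiv p f) := by
  rw [List.map_cons, List.prod_cons, functional_F_mul, neg_eq_iff_add_eq_zero, ← map_add]
  exact functional_prod_eq_zero lam (Nat.lt_succ_self _) (cellRep_add_pderiv_mem lam p hf)

theorem prod_X_mem (l : List (NegIdx r)) :
    ((l.map X).prod : Cell r) ∈ originIdeal r ^ l.length := by
  induction l with
  | nil => simp
  | cons p l ih =>
    rw [List.map_cons, List.prod_cons, List.length_cons, pow_succ']
    exact Ideal.mul_mem_mul (X_mem_originIdeal p) ih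

theorem X_mul_pderiv_prod [BEq (NegIdx r)] [LawfulBEq (NegIdx r)] (p : NegIdx r)
    (l : List (NegIdx r)) :
    X p * pderiv p ((l.map X).prod : Cell r) = (l.count p : ℂ) • (l.map X).prod := by
  induction l with
  | nil => simp
  | cons q l ih =>
    rw [List.map_cons, List.prod_cons, Derivation.leibniz, smul_eq_mul, smul_eq_mul, mul_add,
      mul_left_comm, ih, pderiv_X]
    rcases eq_or_ne q p with rfl | h
    · rw [Pi.single_eq_same, List.count_cons_self, mul_one, Nat.cast_succ, add_smul, one_smul,
        mul_smul_comm]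
    · rw [Pi.single_eq_of_ne h, List.count_cons_of_ne h, mul_zero, mul_zero, add_zero,
        mul_smul_comm]

/-- To top order the root vectors act as the derivatives `∂_p`, and `∂_p` of `X p` times a monomial
is that monomial times one plus its exponent of `X p`, a nonzero scalar. -/
theorem functional_prod_ne_zero (lam : Wt r) (l : List (NegIdx r)) :
    functional lam (l.map F).prod (l.map X).prod ≠ 0 := by
  induction l with
  | nil =>
    rw [List.map_nil, List.prod_nil, functional, map_one]
    simp
  | cons p l ih =>
    have hadd : ∀ (c : ℂ) (f : Cell r), c • f + f = (c + 1) • f := fun c f => by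
      rw [add_smul, one_smul]
    rw [functional_cons lam p l (prod_X_mem (p :: l)), List.map_cons, List.prod_cons,
      Derivation.leibniz, smul_eq_mul, smul_eq_mul, X_mul_pderiv_prod, pderiv_X_self, mul_one,
      hadd, map_smul]
    exact smul_ne_zero (Nat.cast_add_one_ne_zero _) ih

/-- For `A` in `𝔟` the vector field vanishes at the identity, and only the multiplier, whose value
there is `λ` of the diagonal of `A`, survives. -/
theorem functional_of_mem_borel (lam : Wt r) (A : borel r) :
    dualRep lam (A : SL r) (origin r).toLinearMap
      = charB lam A • (origin r).toLinearMap := by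
  refine LinearMap.ext fun f => ?_
  change -origin r (cellRep lam (A : SL r) f) = lam (diagPart r (A : SL r)) * origin r f
  have h1 : field (A : SL r).1 f ∈ originIdeal r := by
    refine derivation_mem (fun p => ?_) f
    rw [originIdeal, RingHom.mem_ker]
    change origin r _ = 0
    rw [origin_field_X, A.2 _ _ p.2, neg_zero]
  have h2 : lam (diagPart r (A : SL r)) = ∑ l, lam (hdiag l) * (A : SL r).1 l l := by
    conv_lhs => rw [cartan_eq_sum (diagPart r (A : SL r)), map_sum]
    refine Finset.sum_congr rfl fun l _ => ?_
    rw [map_smul, smul_eq_mul, mul_comm]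
    congr 1
    exact Matrix.diagonal_apply_eq _ _
  have h3 : origin r (field (A : SL r).1 f) = 0 := h1
  rw [cellRep_apply, map_sub, map_mul, origin_mult, h2, h3]
  ring

/-- The lift of `L → S` is, by uniqueness, a section of the inclusion of `S`. -/
theorem enveloping_induction {L : Type*} [LieRing L] [LieAlgebra ℂ L]
    (S : Subalgebra ℂ (UniversalEnvelopingAlgebra ℂ L))
    (h : ∀ x, UniversalEnvelopingAlgebra.ι ℂ x ∈ S) (u : UniversalEnvelopingAlgebra ℂ L) :
    u ∈ S := by
  let g : L →ₗ⁅ℂ⁆ S :=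
    { toFun := fun x => ⟨UniversalEnvelopingAlgebra.ι ℂ x, h x⟩
      map_add' := fun x y => Subtype.ext (map_add _ _ _)
      map_smul' := fun c x => Subtype.ext (map_smul _ _ _)
      map_lie' := by
        intro x y
        exact Subtype.ext (LieHom.map_lie _ _ _) }
  have h1 : S.val.comp (UniversalEnvelopingAlgebra.lift ℂ g)
      = AlgHom.id ℂ (UniversalEnvelopingAlgebra ℂ L) := by
    refine UniversalEnvelopingAlgebra.hom_ext ℂ ?_
    refine LieHom.ext fun x => ?_
    change S.val (UniversalEnvelopingAlgebra.lift ℂ g (UniversalEnvelopingAlgebra.ι ℂ x)) = _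
    rw [UniversalEnvelopingAlgebra.lift_ι_apply]
    rfl
  have h2 := DFunLike.congr_fun h1 u
  change ((UniversalEnvelopingAlgebra.lift ℂ g u : S) : UniversalEnvelopingAlgebra ℂ L) = u at h2
  rw [← h2]
  exact Subtype.prop _

theorem functional_mul_inclU (lam : Wt r) (u : U r) (b : UB r) :
    functional lam (u * inclU r b) = charU lam b • functional lam u := by
  have h : UniversalEnvelopingAlgebra.lift ℂ (dualRep lam) (inclU r b) (origin r).toLinearMap
      = charU lam b • (origin r).toLinearMap := by
    refine enveloping_induction
      { carrier := {b | UniversalEnvelopingAlgebra.lift ℂ (dualRep lam) (inclU r b)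
          (origin r).toLinearMap = charU lam b • (origin r).toLinearMap}
        mul_mem' := fun {a b} ha hb => ?_
        add_mem' := fun {a b} ha hb => ?_
        algebraMap_mem' := fun c => ?_ } (fun A => ?_) b
    · rw [Set.mem_ofPred_eq] at ha hb ⊢
      rw [map_mul, map_mul, Module.End.mul_apply, hb, map_smul, ha, smul_smul, map_mul, mul_comm]
    · rw [Set.mem_ofPred_eq] at ha hb ⊢
      rw [map_add, map_add, LinearMap.add_apply, ha, hb, map_add, add_smul]
    · rw [Set.mem_ofPred_eq, AlgHom.commutes, AlgHom.commutes, AlgHom.commutes]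
      rfl
    · change UniversalEnvelopingAlgebra.lift ℂ (dualRep lam)
        (inclU r (UniversalEnvelopingAlgebra.ι ℂ A)) (origin r).toLinearMap
          = charU lam (UniversalEnvelopingAlgebra.ι ℂ A) • (origin r).toLinearMap
      rw [inclU, charU, UniversalEnvelopingAlgebra.lift_ι_apply,
        UniversalEnvelopingAlgebra.lift_ι_apply]
      change UniversalEnvelopingAlgebra.lift ℂ (dualRep lam)
        (UniversalEnvelopingAlgebra.ι ℂ (A : SL r)) _ = _
      rw [UniversalEnvelopingAlgebra.lift_ι_apply, functional_of_mem_borel]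
  rw [functional, map_mul, Module.End.mul_apply, h, map_smul, functional]

/-- The functional respects the relations defining `M(λ)`, so `u ↦ functional lam u` factors through
`u ↦ u • vac lam`. -/
theorem functional_eq_zero_of_smul_vac {lam : Wt r} {u : U r} (h : u • vac lam = 0) :
    functional lam u = 0 := by
  let K : Submodule (U r) (U r) :=
    { carrier := {u | functional lam u = 0}
      add_mem' := fun {x y} hx hy => by
        change functional lam (x + y) = 0
        have hx : functional lam x = 0 := hx
        have hy : functional lam y = 0 := hy
        rw [functional] at hx hy ⊢
        rw [map_add, LinearMap.add_apply, hx, hy, add_zero]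
      zero_mem' := by
        change functional lam 0 = 0
        rw [functional, map_zero]
        rfl
      smul_mem' := fun c x hx => by
        change functional lam (c * x) = 0
        have hx : functional lam x = 0 := hx
        rw [functional] at hx ⊢
        rw [map_mul, Module.End.mul_apply, hx, map_zero] }
  have hK : balanced lam ≤ K.comap (TensorProduct.AlgebraTensorModule.rid ℂ (U r) (U r)).toLinearMap := by
    refine Submodule.span_le.2 ?_
    rintro _ ⟨u, b, z, rfl⟩
    change functional lam (TensorProduct.AlgebraTensorModule.rid ℂ (U r) (U r)
      ((u * inclU r b) ⊗ₜ[ℂ] z - u ⊗ₜ[ℂ] (charU lam b * z))) = 0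
    have h1 := functional_mul_inclU lam u b
    rw [functional, functional] at h1
    rw [map_sub, TensorProduct.AlgebraTensorModule.rid_tmul,
      TensorProduct.AlgebraTensorModule.rid_tmul, functional, map_sub, map_smul, map_smul,
      LinearMap.sub_apply, LinearMap.smul_apply, LinearMap.smul_apply, h1, smul_smul, mul_comm,
      sub_self]
  have h1 : u ⊗ₜ[ℂ] (1 : ℂ) ∈ balanced lam := by
    rw [vac, ← map_smul, TensorProduct.smul_tmul', smul_eq_mul, mul_one] at h
    exact (Submodule.Quotient.mk_eq_zero _).1 h
  have h2 : functional lam (TensorProduct.AlgebraTensorModule.rid ℂ (U r) (U r)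
    (u ⊗ₜ[ℂ] (1 : ℂ))) = 0 := hK h1
  rwa [TensorProduct.AlgebraTensorModule.rid_tmul, one_smul] at h2

theorem smul_vac_ne_zero (lam : Wt r) {m : Fin r → ℕ} {u : U r}
    (hu : u - lead m ∈ filt r (∑ i, m i)) : u • vac lam ≠ 0 := by
  intro h
  have h1 := functional_eq_zero_of_smul_vac h
  have h2 := functional_prod_ne_zero lam (leadList m)
  -- The test function is the coordinate monomial matching the leading term; its order of vanishing
  -- exceeds the length of every other term.
  have h3 := functional_eq_zero lam hu (f := ((leadList m).map X).prod)
    (by rw [← length_leadList]; exact prod_X_mem _)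
  rw [functional] at h1 h2 h3
  rw [map_sub, LinearMap.sub_apply, h1, zero_sub, LinearMap.neg_apply, neg_eq_zero,
    lead_eq_prod] at h3
  exact h2 h3

end BigCell

/-! ### Singular vectors of strongly linked weights -/

section Linked

variable {r : ℕ}

theorem borel_smul_vac (lam : Wt r) (A : borel r) :
    UniversalEnvelopingAlgebra.ι ℂ (A : SL r) • vac lam = charB lam A • vac lam := by
  have h : (1 * inclU r (UniversalEnvelopingAlgebra.ι ℂ A)) ⊗ₜ[ℂ] (1 : ℂ)
      - (1 : U r) ⊗ₜ[ℂ] (charU lam (UniversalEnvelopingAlgebra.ι ℂ A) * 1) ∈ balanced lam :=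
    Submodule.subset_span ⟨1, _, 1, rfl⟩
  rw [inclU, charU, UniversalEnvelopingAlgebra.lift_ι_apply,
    UniversalEnvelopingAlgebra.lift_ι_apply, one_mul, ← smul_eq_mul, TensorProduct.tmul_smul] at h
  have h1 := (Submodule.Quotient.eq _).2 h
  change (balanced lam).mkQ (UniversalEnvelopingAlgebra.ι ℂ (A : SL r) • (1 ⊗ₜ[ℂ] 1)) =
    charB lam A • (balanced lam).mkQ (1 ⊗ₜ[ℂ] 1)
  rw [TensorProduct.smul_tmul', smul_eq_mul, mul_one]
  exact h1

theorem isHighest_vac (lam : Wt r) : IsHighest lam (vac lam) := by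
  constructor
  · intro x
    have h := borel_smul_vac lam ⟨x, fun i j hij => x.2 i j hij.le⟩
    refine h.trans ?_
    have h1 : diagPart r (x : SL r) = 0 := by
      ext i j
      change Matrix.diagonal _ i j = 0
      rw [Matrix.diagonal_apply, x.2 i i le_rfl, ite_self]
    change lam (diagPart r (x : SL r)) • vac lam = 0
    rw [h1, map_zero, zero_smul]
  · intro H
    have h := borel_smul_vac lam ⟨H, fun i j hij => H.2 i j hij.ne'⟩
    refine h.trans ?_
    have h1 : diagPart r (H : SL r) = H := by
      ext i j
      change Matrix.diagonal _ i j = (H : SL r).1 i j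
      rw [Matrix.diagonal_apply]
      split_ifs with hij
      · rw [hij]
      · rw [H.2 i j hij]
    change lam (diagPart r (H : SL r)) • vac lam = _
    rw [h1]

theorem dot_refl (β : PosRoot r) (lam : Wt r) :
    dot (refl β) lam = lam - ((lam + rho r) (coroot β)) • root β := by
  change (lam + rho r) - ((lam + rho r) (coroot β)) • root β - rho r = _
  abel

theorem sum_strip {V : Type*} [AddCommGroup V] [Module ℂ V] (f : Fin (r + 1) → V)
    {p q : Fin (r + 1)} (h : p ≤ q) (m : ℕ) :
    (∑ k, (strip p q m k : ℂ) • (f k.castSucc - f k.succ)) = (m : ℂ) • (f p - f q) := by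
  obtain ⟨d, hd⟩ := Nat.exists_eq_add_of_le (Fin.le_def.1 h)
  induction d generalizing p with
  | zero =>
    obtain rfl : q = p := Fin.ext (by omega)
    simp [strip_self]
  | succ d ih =>
    have hr : p.val < r := by
      have := q.2
      omega
    obtain ⟨i, rfl⟩ : ∃ i : Fin r, p = i.castSucc := ⟨⟨p, hr⟩, rfl⟩
    rw [Fin.val_castSucc] at hd
    have hi : i.succ ≤ q := Fin.le_def.2 (by rw [Fin.val_succ]; omega)
    rw [strip_castSucc hi]
    simp only [Pi.add_apply, Nat.cast_add, add_smul]
    rw [Finset.sum_add_distrib, ih hi (by rw [Fin.val_succ]; omega), Finset.sum_eq_single i]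
    · rw [Pi.single_eq_same]
      module
    · intro k _ hk
      rw [Pi.single_eq_of_ne hk, Nat.cast_zero, zero_smul]
    · simp

theorem exists_singular_of_linked {l : List (PosRoot r)} {mu lam : Wt r}
    (h : StronglyLinkedBy l mu lam) : ∃ (m : Fin r → ℕ) (u : U r),
      u - lead m ∈ filt r (∑ i, m i) ∧
      lam - mu = ∑ i, (m i : ℂ) • (e i.castSucc - e i.succ) ∧
      IsHighest mu (u • vac lam) := by
  induction l generalizing mu with
  | nil =>
    obtain rfl : mu = lam := by
      rw [h.1]
      change lam + rho r - rho r = lam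
      abel
    refine ⟨0, 1, ?_, ?_, ?_⟩
    · rw [lead_zero, sub_self]
      exact zero_mem _
    · simp
    · rw [one_smul]
      exact isHighest_vac mu
  | cons β l ih =>
    obtain ⟨m, u, hu, hm, hs⟩ := ih (mu := dot (word l) lam)
      ⟨rfl, fun γ l' hl => h.2 γ l' (hl.trans (List.suffix_cons β l))⟩
    obtain ⟨h1, n, hn, hβ⟩ := h.2 β l List.suffix_rfl
    rw [← h.1, dot_refl, hβ] at h1
    obtain ⟨u', hu', hs'⟩ := exists_singular_of_reflection hs β hn hβ
    set s := strip (r := r) β.1.1 β.1.2 n with hs_def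
    refine ⟨s + m, u' * u, ?_, ?_, ?_⟩
    · have h2 : u' * u - lead (s + m) = (u' - lead s) * u + lead s * (u - lead m)
          + (lead s * lead m - lead (s + m)) := by
        noncomm_ring
      have h3 : ∑ i, (s + m) i = ∑ i, s i + ∑ i, m i := by
        simp [Finset.sum_add_distrib]
      have h4 : u ∈ filt r (∑ i, m i + 1) := by
        rw [← sub_add_cancel u (lead m)]
        exact add_mem (filt_mono (Nat.le_succ _) hu) (lead_mem_filt m)
      rw [h2]
      refine add_mem (add_mem (mul_mem_filt hu' h4 ?_) (mul_mem_filt (lead_mem_filt s) hu ?_))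
        (lead_mul_lead s m) <;> omega
    · rw [h1]
      simp only [Pi.add_apply, Nat.cast_add, add_smul]
      rw [Finset.sum_add_distrib, ← hm, hs_def, sum_strip e β.2.le, root]
      abel
    · rw [mul_smul, h1]
      exact hs'

theorem sum_simple_injective {a b : Fin r → ℂ}
    (h : ∑ i, a i • (e i.castSucc - e i.succ : Wt r)
      = ∑ i, b i • (e i.castSucc - e i.succ : Wt r)) : a = b := by
  funext k
  -- The fundamental coweight dual to the `k`-th simple root; it reads off the `k`-th coefficient.
  let ω : cartan r := diagPart r (traceFree r
    (Matrix.diagonal fun j => if j ≤ k.castSucc then 1 else 0))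
  have hω : ∀ i : Fin r, (e i.castSucc - e i.succ : Wt r) ω = if i = k then 1 else 0 := by
    intro i
    have h1 : ∀ j, e j ω = (if j ≤ k.castSucc then 1 else 0)
        - (Matrix.diagonal fun j => if j ≤ k.castSucc then (1 : ℂ) else 0).trace / (r + 1 : ℂ) := by
      intro j
      change Matrix.diagonal _ j j = _
      rw [Matrix.diagonal_apply_eq]
      change Matrix.diagonal _ j j - (_ • (1 : Matrix (Fin (r + 1)) (Fin (r + 1)) ℂ)) j j = _
      rw [Matrix.diagonal_apply_eq, Matrix.smul_apply, Matrix.one_apply_eq, smul_eq_mul, mul_one]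
    rw [LinearMap.sub_apply, h1, h1, sub_sub_sub_cancel_right]
    have h2 : i.castSucc ≤ k.castSucc ↔ i ≤ k := Iff.rfl
    have h3 : i.succ ≤ k.castSucc ↔ i < k := by
      rw [← Fin.castSucc_lt_iff_succ_le]
      exact Iff.rfl
    simp only [h2, h3]
    rcases lt_trichotomy i k with hk | rfl | hk
    · simp [hk, hk.le, hk.ne]
    · simp
    · simp [hk.not_ge, hk.not_gt, hk.ne']
  have h1 := LinearMap.congr_fun h ω
  simpa only [LinearMap.sum_apply, LinearMap.smul_apply, hω, smul_eq_mul, mul_ite, mul_one,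
    mul_zero, Finset.sum_ite_eq', Finset.mem_univ, if_true] using h1

end Linked

end SlVerma

end

theorem corollary4p5 (r : ℕ) (lam μ : SlVerma.Wt r) (αs : List (SlVerma.PosRoot r))
    (hlink : SlVerma.StronglyLinkedBy αs μ lam)
    (a : Fin r → ℂ)
    (ha : lam - μ = ∑ i : Fin r, a i • (SlVerma.e i.castSucc - SlVerma.e i.succ)) :
    ∃ m : Fin r → ℕ, (∀ i, a i = (m i : ℂ)) ∧
      ∃ v : SlVerma.Verma lam,
        SlVerma.IsSingularVector v ∧ SlVerma.IsWeightVector μ v ∧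
        ∃ c : (SlVerma.NegIdx r → ℕ) →₀ ℂ,
          (∀ b ∈ c.support, SlVerma.deg b < ∑ i, m i) ∧
          v = SlVerma.lead m • SlVerma.vac lam +
            c.sum (fun b z => z • (SlVerma.pbw b • SlVerma.vac lam)) := by
  obtain ⟨m, u, hu, hm, hs⟩ := SlVerma.exists_singular_of_linked hlink
  have ham : a = fun i => (m i : ℂ) := SlVerma.sum_simple_injective (ha.symm.trans hm)
  obtain ⟨c, hc, hcu⟩ := (Finsupp.mem_span_image_iff_linearCombination ℂ).1
    (SlVerma.filt_le_span_pbw _ hu)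
  have hw : SlVerma.IsWeightVector μ (u • SlVerma.vac lam) :=
    ⟨SlVerma.smul_vac_ne_zero lam hu, hs.2⟩
  refine ⟨m, congrFun ham, u • SlVerma.vac lam, ⟨⟨μ, hw⟩, hs.1⟩, hw, c,
    fun b hb => hc hb, ?_⟩
  rw [Finsupp.linearCombination_apply] at hcu
  rw [← sub_add_cancel u (SlVerma.lead m), ← hcu, add_smul, add_comm, Finsupp.sum,
    Finset.sum_smul]
  congr 1
  exact Finset.sum_congr rfl fun b _ => smul_assoc _ _ _
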